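/- For $\tau\in\mathbb{H}$ let $\Lambda_\tau=\mathbb{Z}+\mathbb{Z}\tau$ and $E_\tau=\mathbb{C}/\Lambda_\tau$. A solution of $\triangle u+e^u=4\pi\delta_0$ on $E_\tau$ is a real function $u$ on $E_\tau$, of class $C^2$ off the origin, with $u$ and $e^u$ integrable, such that $\int_{E_\tau}(u\,\triangle h+e^u h)\,dx\,dy=4\pi h(0)$ for every smooth real function $h$ on $E_\tau$. A meromorphic function $f$ on $\mathbb{C}$ is a developing map of $u$ if $u=\log\frac{8|f'|^2}{(1+|f|^2)^2}$ on $\mathbb{C}\smallsetminus\Lambda_\tau$ (in the sense of limits at poles of $f$). For every $\tau\in\mathbb{H}$ let $f(z;\tau)$ be the specially normalized developing map for $\rho=4\pi$, i.e. a meromorphic function of $z\in\mathbb{C}$ which is a developing map of a solution of $\triangle u+e^u=4\pi\delta_0$ on $E_\tau$ and satisfies: $f(z+1;\tau)=-f(z;\tau)$ and $f(z+\tau;\tau)=1/f(z;\tau)$; $f(\cdot\,;\tau)$ has neither zeros nor poles outside $\tfrac12+\Lambda_\tau$; $f(\cdot\,;\tau)$ has a simple zero at $z=\tfrac12$; and $f(\tfrac{\tau}{2};\tau)=1$.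 (These conditions determine $f(\cdot\,;\tau)$.) Let $\mathrm{PSU}(2)$ act on $\mathbb{P}^1(\mathbb{C})$ by Möbius transformations: the class of $\begin{pmatrix}a&b\\-\bar b&\bar a\end{pmatrix}$, $|a|^2+|b|^2=1$, acts by $w\mapsto\frac{aw+b}{-\bar b w+\bar a}$. Let $K_4\subset\mathrm{PSU}(2)$ be Klein's four group consisting of the classes of $\begin{pmatrix}1&0\\0&1\end{pmatrix}$, $\begin{pmatrix}i&0\\0&-i\end{pmatrix}$, $\begin{pmatrix}0&i\\i&0\end{pmatrix}$, $\begin{pmatrix}0&1\\-1&0\end{pmatrix}$, and let $N(K_4)$ be its normalizer in $\mathrm{PSU}(2)$. For $\gamma=\begin{pmatrix}a&b\\c&d\end{pmatrix}\in\mathrm{SL}_2(\mathbb{Z})$ put $\gamma\cdot\tau=\frac{a\tau+b}{c\tau+d}$ and $j(\gamma,\tau)=c\tau+d$. Then $N(K_4)\cong S_4$ and $N(K_4)/K_4\cong S_3$, and the following hold. (a) There is a unique group homomorphism $\psi:\mathrm{SL}_2(\mathbb{Z})\to N(K_4)$ such that $$f\big(j(\gamma,\tau)^{-1}z;\,\gamma\cdot\tau\big)=\psi(\gamma)\cdot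 f(z;\tau)\qquad\forall\,\gamma\in\mathrm{SL}_2(\mathbb{Z}),\ z\in\mathbb{C},\ \tau\in\mathbb{H},$$ as an equality in $\mathbb{P}^1(\mathbb{C})$. (b) $\psi$ is surjective, $\ker\psi$ is the subgroup generated by $-\mathrm{I}_2$ and the principal congruence subgroup $\Gamma(4)$, and $\psi^{-1}(K_4)=\Gamma(2)$. Moreover $\psi$ induces isomorphisms $\mathrm{SL}_2(\mathbb{Z}/4\mathbb{Z})/\{\pm\mathrm{I}_2\}\cong N(K_4)$ and $\mathrm{SL}_2(\mathbb{Z}/2\mathbb{Z})\cong N(K_4)/K_4$. (c) $\psi\begin{pmatrix}1&1\\0&1\end{pmatrix}$ is the class of $\begin{pmatrix}e^{\pi i/4}&0\\0&e^{-\pi i/4}\end{pmatrix}$, and $\psi\begin{pmatrix}0&1\\-1&0\end{pmatrix}$ is the class of $\frac{i}{\sqrt2}\begin{pmatrix}-1&1\\1&1\end{pmatrix}$. (d) For every $\tau\in\mathbb{H}$ the function $f(\cdot\,;\tau)$ is holomorphic at $z=0$; let $f(z;\tau)=\sum_{k\ge0}a_k(\tau)z^k$ be its Taylor expansion there. For every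 $k\ge0$ the function $a_k$ is holomorphic on $\mathbb{H}$, satisfies $a_k(\gamma\cdot\tau)=j(\gamma,\tau)^k a_k(\tau)$ for all $\gamma\in\Gamma(4)$ and $\tau\in\mathbb{H}$, and is meromorphic at the cusps: for every $\gamma\in\mathrm{SL}_2(\mathbb{Z})$ the function $j(\gamma,\tau)^{-k}a_k(\gamma\cdot\tau)$ is, for $\mathrm{Im}\,\tau$ sufficiently large, a function of $q=e^{2\pi i\tau/4}$ that is meromorphic at $q=0$. -/

import Mathlib

open Complex MatrixGroups Topology
open UpperHalfPlane hiding I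
open scoped ContDiff ModularForm Manifold Laplacian

noncomputable section

/-! ### The group `PSU(2)`, its action on the Riemann sphere, and Klein's four group -/

/-- `SU(2)`. -/
abbrev SU2 : Type := Matrix.specialUnitaryGroup (Fin 2) ℂ

/-- `PSU(2)`, the quotient of `SU(2)` by its center. -/
abbrev PSU2 : Type := SU2 ⧸ Subgroup.center SU2

/-- The class in `PSU(2)` of an element of `SU(2)`. -/
abbrev PSU2.mk (A : SU2) : PSU2 := QuotientGroup.mk A

/-- The element `(a, b; -b̄, ā)` of `SU(2)`, for `|a|² + |b|² = 1`. -/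
def SU2.ofPair (a b : ℂ) (h : normSq a + normSq b = 1) : SU2 :=
  ⟨!![a, b; -(starRingEnd ℂ b), starRingEnd ℂ a], by
    have h' : a * starRingEnd ℂ a + b * starRingEnd ℂ b = 1 := by
      rw [Complex.mul_conj, Complex.mul_conj]; exact_mod_cast h
    rw [Matrix.mem_specialUnitaryGroup_iff, Matrix.mem_unitaryGroup_iff]
    constructor
    · ext i j
      fin_cases i <;> fin_cases j <;>
        simp [Matrix.mul_apply, Fin.sum_univ_two, Matrix.star_apply] <;>
        first | ring1 | linear_combination h'
    · rw [Matrix.det_fin_two_of]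
      linear_combination h'⟩

/-- The matrix `(i, 0; 0, -i)`. -/
def kleinA : SU2 := SU2.ofPair I 0 (by simp)
/-- The matrix `(0, i; i, 0)`. -/
def kleinB : SU2 := SU2.ofPair 0 I (by simp)
/-- The matrix `(0, 1; -1, 0)`. -/
def kleinC : SU2 := SU2.ofPair 0 1 (by simp)

theorem kleinA_val : (kleinA : Matrix (Fin 2) (Fin 2) ℂ) = !![I, 0; 0, -I] := by
  simp [kleinA, SU2.ofPair]

theorem kleinB_val : (kleinB : Matrix (Fin 2) (Fin 2) ℂ) = !![0, I; I, 0] := by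
  simp [kleinB, SU2.ofPair]

theorem kleinC_val : (kleinC : Matrix (Fin 2) (Fin 2) ℂ) = !![0, 1; -1, 0] := by
  simp [kleinC, SU2.ofPair]

/-- The unitary matrix `(e^{πi/4}, 0; 0, e^{-πi/4})`. -/
def matT : SU2 := SU2.ofPair (exp (Real.pi * I / 4)) 0 (by
  have : (Real.pi * I / 4 : ℂ) = ((Real.pi / 4 : ℝ) : ℂ) * I := by push_cast; ring
  rw [this, Complex.normSq_eq_norm_sq, Complex.norm_exp_ofReal_mul_I]; simp)

/-- The unitary matrix `(i/√2) (-1, 1; 1, 1)`. -/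
def matS : SU2 := SU2.ofPair (-(I / (√2 : ℝ))) (I / (√2 : ℝ)) (by
  simp [Complex.normSq_eq_norm_sq]; norm_num)

theorem matT_val : (matT : Matrix (Fin 2) (Fin 2) ℂ) =
    !![exp (Real.pi * I / 4), 0; 0, exp (-(Real.pi * I / 4))] := by
  simp [matT, SU2.ofPair, ← Complex.exp_conj, Complex.conj_ofNat, neg_div]

theorem matS_val : (matS : Matrix (Fin 2) (Fin 2) ℂ) =
    (I / (√2 : ℝ)) • !![-1, 1; 1, 1] := by
  ext i j
  fin_cases i <;> fin_cases j <;> simp [matS, SU2.ofPair] <;> ring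

theorem PSU2.mk_eq_of_neg {A B : SU2}
    (h : (A : Matrix (Fin 2) (Fin 2) ℂ) = -(B : Matrix (Fin 2) (Fin 2) ℂ)) :
    PSU2.mk A = PSU2.mk B := by
  have hA : (A⁻¹ : SU2).1 * A.1 = 1 := congrArg Subtype.val (inv_mul_cancel A)
  have key : (A⁻¹ * B : SU2).1 = -1 := by
    have hB : B.1 = -A.1 := by rw [h, neg_neg]
    change (A⁻¹ : SU2).1 * B.1 = -1
    rw [hB, mul_neg, hA]
  refine QuotientGroup.eq.2 (Subgroup.mem_center_iff.2 fun g => Subtype.ext ?_)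
  change g.1 * (A⁻¹ * B : SU2).1 = (A⁻¹ * B : SU2).1 * g.1
  rw [key, mul_neg, neg_mul, mul_one, one_mul]

theorem klein_mul (A B C : SU2)
    (h : (A : Matrix (Fin 2) (Fin 2) ℂ) * (B : Matrix (Fin 2) (Fin 2) ℂ) =
        (C : Matrix (Fin 2) (Fin 2) ℂ) ∨
      (A : Matrix (Fin 2) (Fin 2) ℂ) * (B : Matrix (Fin 2) (Fin 2) ℂ) =
        -(C : Matrix (Fin 2) (Fin 2) ℂ)) :
    PSU2.mk A * PSU2.mk B = PSU2.mk C := by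
  change PSU2.mk (A * B) = PSU2.mk C
  rcases h with h | h
  · exact congrArg _ (Subtype.ext h)
  · exact PSU2.mk_eq_of_neg h

/-- Klein's four group in `PSU(2)`: the classes of the identity matrix and of
`(i, 0; 0, -i)`, `(0, i; i, 0)`, `(0, 1; -1, 0)`. -/
def K4 : Subgroup PSU2 where
  carrier := {1, PSU2.mk kleinA, PSU2.mk kleinB, PSU2.mk kleinC}
  one_mem' := by simp
  mul_mem' := by
    have hAA := klein_mul kleinA kleinA 1 (by simp [kleinA_val, Matrix.one_fin_two])
    have hBB := klein_mul kleinB kleinB 1 (by simp [kleinB_val, Matrix.one_fin_two])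
    have hCC := klein_mul kleinC kleinC 1 (by simp [kleinC_val, Matrix.one_fin_two])
    have hAB := klein_mul kleinA kleinB kleinC (by simp [kleinA_val, kleinB_val, kleinC_val])
    have hBA := klein_mul kleinB kleinA kleinC (by simp [kleinA_val, kleinB_val, kleinC_val])
    have hAC := klein_mul kleinA kleinC kleinB (by simp [kleinA_val, kleinB_val, kleinC_val])
    have hCA := klein_mul kleinC kleinA kleinB (by simp [kleinA_val, kleinB_val, kleinC_val])
    have hBC := klein_mul kleinB kleinC kleinA (by simp [kleinA_val, kleinB_val, kleinC_val])
    have hCB := klein_mul kleinC kleinB kleinA (by simp [kleinA_val, kleinB_val, kleinC_val])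
    rintro x y (rfl | rfl | rfl | rfl) (rfl | rfl | rfl | rfl) <;>
      simp [hAA, hBB, hCC, hAB, hBA, hAC, hCA, hBC, hCB]
  inv_mem' := by
    have hAA := klein_mul kleinA kleinA 1 (by simp [kleinA_val, Matrix.one_fin_two])
    have hBB := klein_mul kleinB kleinB 1 (by simp [kleinB_val, Matrix.one_fin_two])
    have hCC := klein_mul kleinC kleinC 1 (by simp [kleinC_val, Matrix.one_fin_two])
    rintro x (rfl | rfl | rfl | rfl)
    · simp
    · rw [inv_eq_of_mul_eq_one_left hAA]; simp
    · rw [inv_eq_of_mul_eq_one_left hBB]; simp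
    · rw [inv_eq_of_mul_eq_one_left hCC]; simp

/-- The normalizer `N(K₄)` of `K₄` in `PSU(2)`. -/
abbrev NK4 : Subgroup PSU2 := Subgroup.normalizer (K4 : Set PSU2)

/-- The inclusion of `SU(2)` in `GL₂(ℂ)`. -/
def SU2.toGL : SU2 →* GL (Fin 2) ℂ :=
  (Matrix.specialUnitaryGroup (Fin 2) ℂ).subtype.toHomUnits

/-- The action of `SU(2)` on the Riemann sphere `ℂ ∪ {∞}` by Möbius transformations,
`(a, b; c, d) · w = (a w + b) / (c w + d)`. -/
def SU2.moebius : SU2 →* Equiv.Perm (OnePoint ℂ) :=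
  (MulAction.toPermHom (GL (Fin 2) ℂ) (OnePoint ℂ)).comp SU2.toGL

theorem SU2.toGL_val (A : SU2) :
    ((SU2.toGL A : GL (Fin 2) ℂ) : Matrix (Fin 2) (Fin 2) ℂ) = A.1 := rfl

theorem SU2.center_le_ker : Subgroup.center SU2 ≤ SU2.moebius.ker := by
  intro Z hZ
  have hc (B : SU2) : B.1 * Z.1 = Z.1 * B.1 :=
    congrArg Subtype.val (Subgroup.mem_center_iff.1 hZ B)
  have hA := hc kleinA
  have hC := hc kleinC
  rw [kleinA_val] at hA
  rw [kleinC_val] at hC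
  have h01 : Z.1 0 1 = 0 := by
    have h := congrFun (congrFun hA 0) 1
    simp [Matrix.mul_apply, Fin.sum_univ_two] at h
    have : (2 * I) * Z.1 0 1 = 0 := by linear_combination h
    simpa using this
  have h10 : Z.1 1 0 = 0 := by
    have h := congrFun (congrFun hA 1) 0
    simp [Matrix.mul_apply, Fin.sum_univ_two] at h
    have : (2 * I) * Z.1 1 0 = 0 := by linear_combination -h
    simpa using this
  have h11 : Z.1 1 1 = Z.1 0 0 := by
    have h := congrFun (congrFun hC 0) 1
    simpa [Matrix.mul_apply, Fin.sum_univ_two] using h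
  have hdet : Z.1 0 0 ≠ 0 := by
    have h := (Matrix.mem_specialUnitaryGroup_iff.1 Z.2).2
    rw [Matrix.det_fin_two, h01, h11] at h
    intro h0
    simp [h0] at h
  refine MonoidHom.mem_ker.2 (Equiv.ext fun w => ?_)
  change SU2.toGL Z • w = w
  induction w using OnePoint.rec with
  | infty => rw [OnePoint.smul_infty_eq_ite, SU2.toGL_val, h10]; simp
  | coe w =>
    rw [OnePoint.smul_some_eq_ite, SU2.toGL_val, h10, h01, h11]
    simp [hdet]

/-- The action of `PSU(2)` on the Riemann sphere, induced by that of `SU(2)`. -/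
def PSU2.moebius : PSU2 →* Equiv.Perm (OnePoint ℂ) :=
  QuotientGroup.lift _ SU2.moebius SU2.center_le_ker

instance PSU2.mulActionSphere : MulAction PSU2 (OnePoint ℂ) := MulAction.compHom _ PSU2.moebius

theorem PSU2.mk_smul (A : SU2) (w : OnePoint ℂ) : PSU2.mk A • w = SU2.toGL A • w := rfl

/-- The subgroup `{± I}` of `SL₂(ℤ/4ℤ)` is normal. -/
instance negOneZMod4_normal : (Subgroup.zpowers (-1 : SL(2, ZMod 4))).Normal :=
  ⟨fun x hx g => by
    obtain ⟨n, rfl⟩ := Subgroup.mem_zpowers_iff.1 hx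
    have hcomm : Commute g ((-1 : SL(2, ZMod 4)) ^ n) :=
      Commute.zpow_right (by change g * -1 = -1 * g; simp) n
    rw [hcomm.eq, mul_inv_cancel_right]
    exact Subgroup.zpow_mem_zpowers _ _⟩

/-! ### The singular Liouville equation on a flat torus and its developing maps -/

/-- The lattice `Λ_τ = ℤ + ℤ τ`. -/
def latticeOf (τ : ℍ) : Set ℂ := {z | ∃ m n : ℤ, z = m + n * (τ : ℂ)}

/-- The fundamental parallelogram `{s + t τ : 0 ≤ s, t < 1}` of `Λ_τ`. -/
def fundPar (τ : ℍ) : Set ℂ :=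
  {z | ∃ s t : ℝ, 0 ≤ s ∧ s < 1 ∧ 0 ≤ t ∧ t < 1 ∧ z = s + t * (τ : ℂ)}

/-- A function on the torus `E_τ = ℂ / Λ_τ`, viewed as a `Λ_τ`-periodic function on `ℂ`. -/
def TorusPeriodic (τ : ℍ) (h : ℂ → ℝ) : Prop :=
  ∀ z : ℂ, h (z + 1) = h z ∧ h (z + τ) = h z

/-- `u` is a solution of `Δ u + e^u = ρ δ₀` on the torus `E_τ = ℂ / Λ_τ`: `u` is a real function
on `E_τ`, of class `C²` off the origin, with `u` and `e^u` integrable, such that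
`∫_{E_τ} (u Δh + e^u h) dx dy = ρ h(0)` for every smooth function `h` on `E_τ`. -/
structure IsLiouvilleSolution (τ : ℍ) (ρ : ℝ) (u : ℂ → ℝ) : Prop where
  periodic : TorusPeriodic τ u
  contDiffOn : ContDiffOn ℝ 2 u (latticeOf τ)ᶜ
  integrableOn : MeasureTheory.IntegrableOn u (fundPar τ)
  integrableOn_exp : MeasureTheory.IntegrableOn (fun z => Real.exp (u z)) (fundPar τ)
  equation : ∀ h : ℂ → ℝ, ContDiff ℝ ∞ h → TorusPeriodic τ h →
    ∫ z in fundPar τ, (u z * (Δ h) z + Real.exp (u z) * h z) = ρ * h 0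

/-- The density `8 |f'|² / (1 + |f|²)²`. -/
def sphericalDensity (f : ℂ → ℂ) (z : ℂ) : ℝ :=
  8 * ‖deriv f z‖ ^ 2 / (1 + ‖f z‖ ^ 2) ^ 2

/-- The meromorphic function `f` on `ℂ` is a developing map of the function `u` on `E_τ`:
`u = log (8 |f'|² / (1 + |f|²)²)` off the lattice. At a pole of `f` this means that the right-hand
side tends to the value of `u`. Meromorphic functions on `ℂ` are represented by functions `ℂ → ℂ`
in normal form: analytic where they have no pole, and with the conventional value `0` at poles. -/
structure IsDevelopingMap (τ : ℍ) (u : ℂ → ℝ) (f : ℂ → ℂ) : Prop where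
  meromorphic : MeromorphicNFOn f Set.univ
  eq_of_regular : ∀ z, z ∉ latticeOf τ → 0 ≤ meromorphicOrderAt f z →
    0 < sphericalDensity f z ∧ u z = Real.log (sphericalDensity f z)
  tendsto_of_pole : ∀ z, z ∉ latticeOf τ → meromorphicOrderAt f z < 0 →
    Filter.Tendsto (fun w => Real.log (sphericalDensity f w)) (𝓝[≠] z) (𝓝 (u z))

/-- The developing map is normalized of type I: `f(z + 1) = -f(z)` and `f(z + τ) = 1 / f(z)`.
(For functions in normal form, `0⁻¹ = 0` matches zeros of `f` with poles of `1 / f`.) -/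
def IsNormalizedTypeI (τ : ℍ) (f : ℂ → ℂ) : Prop :=
  (∀ z, f (z + 1) = -f z) ∧ ∀ z, f (z + τ) = (f z)⁻¹

/-- The specially normalized developing map `f(z; τ)` for `ρ = 4π`: a normalized developing map of
type I of a solution of `Δ u + e^u = 4π δ₀` on `E_τ`, without zeros or poles outside `1/2 + Λ_τ`,
with a simple zero at `1/2`, and with value `1` at `τ/2`. -/
structure IsSpecialDevelopingMap (τ : ℍ) (f : ℂ → ℂ) : Prop where
  developing : ∃ u : ℂ → ℝ, IsLiouvilleSolution τ (4 * Real.pi) u ∧ IsDevelopingMap τ u f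
  typeI : IsNormalizedTypeI τ f
  order_eq_zero : ∀ z, z - 1 / 2 ∉ latticeOf τ → meromorphicOrderAt f z = 0
  order_half : meromorphicOrderAt f (1 / 2) = 1
  value_half_tau : f ((τ : ℂ) / 2) = 1

/-- The value in `ℂ ∪ {∞}` of a meromorphic function in normal form. -/
def sphereValue (f : ℂ → ℂ) (z : ℂ) : OnePoint ℂ :=
  open Classical in
  if meromorphicOrderAt f z < 0 then OnePoint.infty else ((f z : ℂ) : OnePoint ℂ)

/-- The cocycle `j(γ, τ) = c τ + d`. -/
def cocycleJ (γ : SL(2, ℤ)) (τ : ℍ) : ℂ := ((γ 1 0 : ℤ) : ℂ) * (τ : ℂ) + ((γ 1 1 : ℤ) : ℂ)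

/-- The transformation law `f(j(γ, τ)⁻¹ z; γ τ) = ψ(γ) · f(z; τ)`. -/
def TransformationLaw (f : ℍ → ℂ → ℂ) (ψ : SL(2, ℤ) →* NK4) : Prop :=
  ∀ (γ : SL(2, ℤ)) (τ : ℍ) (z : ℂ),
    sphereValue (f (γ • τ)) ((cocycleJ γ τ)⁻¹ * z) = (ψ γ : PSU2) • sphereValue (f τ) z

/-- The Taylor coefficient `a_k(τ)` of `z^k` in `f(z; τ)` at `z = 0`. -/
def taylorCoeff (f : ℍ → ℂ → ℂ) (k : ℕ) (τ : ℍ) : ℂ :=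
  iteratedDeriv k (f τ) 0 / (k.factorial : ℂ)

/-- A weight `k` form `a` for `Γ(4)` is meromorphic at all cusps: for every `γ ∈ SL₂(ℤ)` the
function `a ∣[k] γ`, near `i∞`, is a function of `q = e^{2πiτ/4}` that is meromorphic at `q = 0`. -/
def MeromorphicAtCusps (k : ℤ) (a : ℍ → ℂ) : Prop :=
  ∀ γ : SL(2, ℤ), ∃ Φ : ℂ → ℂ, MeromorphicAt Φ 0 ∧
    ∀ᶠ τ : ℍ in UpperHalfPlane.atImInfty,
      (a ∣[k] γ) τ = Φ (exp (2 * Real.pi * I * (τ : ℂ) / 4))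

end

/-! Translations by `1` and `τ` act on the values of `f(·; τ)` by `w ↦ -w` and `w ↦ 1/w`. Hence `f`
is elliptic for `2ℤ + 2ℤτ`, with simple zeros on `1/2 + ℤ + 2ℤτ`, simple poles on the translate of
this set by `τ`, and values `±1` on `τ/2 + Λ_τ`. By Liouville's theorem, identities between such
functions reduce to comparing zeros and poles and evaluating at one point.

Two identities suffice, since `S` and `T` generate `SL₂(ℤ)`. For `T`, `f = q N / D` with `q =
e^{2πiτ/4}` and theta products `N`, `D` that involve only `q⁴` and `q⁸` (`mul_thetaDen`); replacing
`τ` by `τ + 1` replaces `q` by `iq`, so `f` becomes `i f`. For `S⁻¹`, with `τ'τ = -1` and `g`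
belonging to `τ'`, the function `(f(z) + 1)(g(τ'z) + 1)` has no poles and equals `2`
(`sphereValue_inversion`). An element of `PSU(2)` is determined by its action on the values `0, 1,
∞` of `f`, so each `γ` has only one possible `ψ(γ)`; uniqueness gives multiplicativity, and no
relation of `SL₂(ℤ)` has to be checked (`exists_psi`).

Conjugation by `ψ(γ)` on `K₄` is read off from `γ` mod `2` (`lawAt_shift`). As `K₄` is its own
centralizer, `ψ⁻¹(K₄) = Γ(2)`; evaluating at two half-periods then singles out the kernel inside
`Γ(2)` (`lawAt_eq_one_iff`). Surjectivity holds because `matT` and `matS` generate `N(K₄)`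
(`NK4_le`). Its order is `6 · 4 = 24`, and the faithful action of `SL₂(ℤ/4)/{±1}` on four binary
quadratic forms identifies it with `S₄`.

For the Taylor coefficients, those of `N` and `D` are holomorphic in `q` on the unit disc, and those
of `f` follow by solving `f D = q N` recursively. The other cusps need no new expansion: `f(j⁻¹z;
γτ)` is a Möbius transform of `f(z; τ)`, to which the same recursion applies (`qFamily_rescaled`).
-/

/-! ### Möbius transformations in `PSU(2)`, Klein's group and its centralizer. -/

theorem PSU2.mk_smul_coe (A : SU2) (w : ℂ) : PSU2.mk A • (w : OnePoint ℂ) =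
    if A.1 1 0 * w + A.1 1 1 = 0 then OnePoint.infty
    else (((A.1 0 0 * w + A.1 0 1) / (A.1 1 0 * w + A.1 1 1) : ℂ) : OnePoint ℂ) := by
  rw [PSU2.mk_smul, OnePoint.smul_some_eq_ite, SU2.toGL_val]

theorem PSU2.mk_smul_infty (A : SU2) : PSU2.mk A • (OnePoint.infty : OnePoint ℂ) =
    if A.1 1 0 = 0 then OnePoint.infty
    else ((A.1 0 0 / A.1 1 0 : ℂ) : OnePoint ℂ) := by
  rw [PSU2.mk_smul, OnePoint.smul_infty_eq_ite, SU2.toGL_val]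

/-- An element of `PSU(2)` that fixes `0`, `1` and `∞` is trivial. -/
theorem PSU2.eq_one_of_fixes (x : PSU2) (h0 : x • ((0 : ℂ) : OnePoint ℂ) = ((0 : ℂ) : OnePoint ℂ))
    (h1 : x • ((1 : ℂ) : OnePoint ℂ) = ((1 : ℂ) : OnePoint ℂ))
    (hi : x • (OnePoint.infty : OnePoint ℂ) = OnePoint.infty) : x = 1 := by
  obtain ⟨M, rfl⟩ := QuotientGroup.mk_surjective x
  change PSU2.mk M • _ = _ at h0 h1 hi
  rw [PSU2.mk_smul_infty] at hi
  have h10 : M.1 1 0 = 0 := by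
    by_contra h
    rw [if_neg h] at hi
    exact OnePoint.coe_ne_infty _ hi
  have hdet := (Matrix.mem_specialUnitaryGroup_iff.1 M.2).2
  rw [Matrix.det_fin_two, h10, mul_zero, sub_zero] at hdet
  have h11 : M.1 1 1 ≠ 0 := right_ne_zero_of_mul_eq_one hdet
  rw [PSU2.mk_smul_coe, h10, if_neg (by simpa using h11), OnePoint.coe_eq_coe] at h0 h1
  have h01 : M.1 0 1 = 0 := by simpa [h11] using h0
  have h00 : M.1 0 0 = M.1 1 1 := by
    rwa [h01, mul_one, add_zero, mul_one, zero_add, div_eq_one_iff_eq h11] at h1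
  refine (QuotientGroup.eq_one_iff M).2 (Subgroup.mem_center_iff.2 fun g => Subtype.ext ?_)
  change g.1 * M.1 = M.1 * g.1
  have hM : M.1 = M.1 1 1 • (1 : Matrix (Fin 2) (Fin 2) ℂ) := by
    ext i j
    fin_cases i <;> fin_cases j <;> simp [h10, h01, h00]
  rw [hM]
  simp

theorem PSU2.eq_of_agree (x y : PSU2)
    (h0 : x • ((0 : ℂ) : OnePoint ℂ) = y • ((0 : ℂ) : OnePoint ℂ))
    (h1 : x • ((1 : ℂ) : OnePoint ℂ) = y • ((1 : ℂ) : OnePoint ℂ))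
    (hi : x • (OnePoint.infty : OnePoint ℂ) = y • OnePoint.infty) : x = y := by
  have : y⁻¹ * x = 1 := by
    apply PSU2.eq_one_of_fixes <;> simp only [mul_smul, h0, h1, hi, inv_smul_smul]
  rw [inv_mul_eq_one] at this
  exact this.symm

/-- The class of `kleinA`, acting by `w ↦ -w`. -/
abbrev kA : PSU2 := PSU2.mk kleinA
/-- The class of `kleinB`, acting by `w ↦ 1 / w`. -/
abbrev kB : PSU2 := PSU2.mk kleinB
/-- The class of `kleinC`, acting by `w ↦ -1 / w`. -/
abbrev kC : PSU2 := PSU2.mk kleinC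

theorem kA_smul_coe (w : ℂ) : kA • (w : OnePoint ℂ) = ((-w : ℂ) : OnePoint ℂ) := by
  rw [PSU2.mk_smul_coe, kleinA_val]
  simp [div_neg, mul_comm I]

theorem kA_smul_infty : kA • (OnePoint.infty : OnePoint ℂ) = OnePoint.infty := by
  rw [PSU2.mk_smul_infty, kleinA_val]
  simp

theorem kB_smul_coe {w : ℂ} (hw : w ≠ 0) :
    kB • (w : OnePoint ℂ) = ((w⁻¹ : ℂ) : OnePoint ℂ) := by
  rw [PSU2.mk_smul_coe, kleinB_val]
  simp only [Matrix.of_apply, Matrix.cons_val', Matrix.cons_val_zero, Matrix.cons_val_one,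
    Matrix.cons_val_fin_one, add_zero, zero_mul, zero_add]
  rw [if_neg (mul_ne_zero I_ne_zero hw)]
  congr 1
  field_simp

theorem kB_smul_zero : kB • ((0 : ℂ) : OnePoint ℂ) = OnePoint.infty := by
  rw [PSU2.mk_smul_coe, kleinB_val]
  simp

theorem kB_smul_infty : kB • (OnePoint.infty : OnePoint ℂ) = ((0 : ℂ) : OnePoint ℂ) := by
  rw [PSU2.mk_smul_infty, kleinB_val]
  simp

theorem kA_mul_kA : kA * kA = 1 :=
  klein_mul kleinA kleinA 1 (by simp [kleinA_val, Matrix.one_fin_two])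

theorem kB_mul_kB : kB * kB = 1 :=
  klein_mul kleinB kleinB 1 (by simp [kleinB_val, Matrix.one_fin_two])

theorem kC_mul_kC : kC * kC = 1 :=
  klein_mul kleinC kleinC 1 (by simp [kleinC_val, Matrix.one_fin_two])

theorem kA_mul_kB : kA * kB = kC :=
  klein_mul kleinA kleinB kleinC (by simp [kleinA_val, kleinB_val, kleinC_val])

theorem mem_K4_iff {x : PSU2} : x ∈ K4 ↔ x = 1 ∨ x = kA ∨ x = kB ∨ x = kC := Iff.rfl

theorem kA_mem : kA ∈ K4 := mem_K4_iff.2 (by simp)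
theorem kB_mem : kB ∈ K4 := mem_K4_iff.2 (by simp)
theorem kC_mem : kC ∈ K4 := mem_K4_iff.2 (by simp)

theorem kA_ne_one : kA ≠ 1 := fun h => by
  have := kA_smul_coe 1
  rw [h, one_smul, OnePoint.coe_eq_coe] at this
  norm_num at this

theorem kB_ne_one : kB ≠ 1 := fun h => by
  have := kB_smul_zero
  rw [h, one_smul] at this
  exact OnePoint.coe_ne_infty _ this

theorem kA_ne_kB : kA ≠ kB := fun h => by
  have := kB_smul_zero
  rw [← h, kA_smul_coe] at this
  exact OnePoint.coe_ne_infty _ this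

theorem kC_ne_one : kC ≠ 1 := fun h => kA_ne_kB (by
  rw [← kA_mul_kB] at h
  rw [eq_inv_of_mul_eq_one_left h, eq_comm, ← eq_inv_of_mul_eq_one_left kB_mul_kB])

theorem kC_ne_kA : kC ≠ kA := fun h => kB_ne_one (by
  rw [← kA_mul_kB] at h
  simpa using h)

theorem kC_ne_kB : kC ≠ kB := fun h => kA_ne_one (by
  rw [← kA_mul_kB] at h
  simpa using h)

theorem K4_comm {x y : PSU2} (hx : x ∈ K4) (hy : y ∈ K4) : x * y = y * x := by
  have hsq : ∀ z ∈ K4, z * z = 1 := by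
    rintro z (rfl | rfl | rfl | rfl)
    · simp
    · exact kA_mul_kA
    · exact kB_mul_kB
    · exact kC_mul_kC
  have h := hsq _ (K4.mul_mem hx hy)
  have h1 := eq_inv_of_mul_eq_one_left h
  rwa [mul_inv_rev, ← eq_inv_of_mul_eq_one_left (hsq x hx),
    ← eq_inv_of_mul_eq_one_left (hsq y hy)] at h1

theorem kA_fixed {w : OnePoint ℂ} (h : kA • w = w) :
    w = ((0 : ℂ) : OnePoint ℂ) ∨ w = OnePoint.infty := by
  induction w using OnePoint.rec with
  | infty => exact Or.inr rfl
  | coe w =>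
    left
    rw [kA_smul_coe, OnePoint.coe_eq_coe] at h
    rw [self_eq_neg.1 h.symm]

theorem kB_fixed {w : OnePoint ℂ} (h : kB • w = w) :
    w = ((1 : ℂ) : OnePoint ℂ) ∨ w = ((-1 : ℂ) : OnePoint ℂ) := by
  induction w using OnePoint.rec with
  | infty => rw [kB_smul_infty] at h; exact absurd h (OnePoint.coe_ne_infty _)
  | coe w =>
    rcases eq_or_ne w 0 with rfl | hw
    · rw [kB_smul_zero] at h; exact absurd h.symm (OnePoint.coe_ne_infty _)
    rw [kB_smul_coe hw, OnePoint.coe_eq_coe] at h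
    have : w * w = 1 := by
      nth_rewrite 1 [← h]
      exact inv_mul_cancel₀ hw
    rcases mul_self_eq_one_iff.1 this with rfl | rfl
    · exact Or.inl rfl
    · exact Or.inr rfl

/-- `K₄` is its own centralizer in `PSU(2)`. -/
theorem mem_K4_of_commute {x : PSU2} (hA : x * kA = kA * x) (hB : x * kB = kB * x) : x ∈ K4 := by
  have key : ∀ y : PSU2, y * kB = kB * y → y • ((0 : ℂ) : OnePoint ℂ) = ((0 : ℂ) : OnePoint ℂ) →
      y • ((1 : ℂ) : OnePoint ℂ) = ((1 : ℂ) : OnePoint ℂ) → y = 1 := by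
    intro y hy h0 h1
    refine PSU2.eq_one_of_fixes y h0 h1 ?_
    rw [← kB_smul_zero, ← mul_smul, hy, mul_smul, h0]
  -- Commuting with `kA` and `kB` forces `x` to preserve their fixed-point sets `{0, ∞}` and `{1,
  -- -1}`. A suitable `k ∈ K₄` makes `k x` fix both `0` and `1`, and then also `∞ = kB • 0`.
  have h0 := kA_fixed (w := x • ((0 : ℂ) : OnePoint ℂ)) (by
    rw [← mul_smul, ← hA, mul_smul, kA_smul_coe, neg_zero])
  have h1 := kB_fixed (w := x • ((1 : ℂ) : OnePoint ℂ)) (by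
    rw [← mul_smul, ← hB, mul_smul, kB_smul_coe one_ne_zero, inv_one])
  have hcomm : ∀ k ∈ K4, (k * x) * kB = kB * (k * x) := by
    intro k hk
    rw [mul_assoc, hB, ← mul_assoc, K4_comm hk kB_mem, mul_assoc]
  suffices ∃ k ∈ K4, k * x = 1 by
    obtain ⟨k, hk, h⟩ := this
    rw [eq_inv_of_mul_eq_one_right h]
    exact K4.inv_mem hk
  have hA1 : kA • ((-1 : ℂ) : OnePoint ℂ) = ((1 : ℂ) : OnePoint ℂ) := by
    rw [kA_smul_coe, neg_neg]
  have hB1 : kB • ((1 : ℂ) : OnePoint ℂ) = ((1 : ℂ) : OnePoint ℂ) := by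
    rw [kB_smul_coe one_ne_zero, inv_one]
  have hA0 : kA • ((0 : ℂ) : OnePoint ℂ) = ((0 : ℂ) : OnePoint ℂ) := by
    rw [kA_smul_coe, neg_zero]
  rcases h0 with h0 | h0 <;> rcases h1 with h1 | h1
  · exact ⟨1, K4.one_mem, key _ (hcomm _ K4.one_mem) (by rwa [one_mul]) (by rwa [one_mul])⟩
  · exact ⟨kA, kA_mem, key _ (hcomm _ kA_mem) (by rw [mul_smul, h0, hA0])
      (by rw [mul_smul, h1, hA1])⟩
  · exact ⟨kB, kB_mem, key _ (hcomm _ kB_mem) (by rw [mul_smul, h0, kB_smul_infty])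
      (by rw [mul_smul, h1, hB1])⟩
  · exact ⟨kB * kA, K4.mul_mem kB_mem kA_mem, key _ (hcomm _ (K4.mul_mem kB_mem kA_mem))
      (by rw [mul_smul, mul_smul, h0, kA_smul_infty, kB_smul_infty])
      (by rw [mul_smul, mul_smul, h1, hA1, hB1])⟩

/-! ### The generators `matT` and `matS` of the normalizer. -/

theorem matT_smul_coe (w : ℂ) :
    PSU2.mk matT • (w : OnePoint ℂ) = ((I * w : ℂ) : OnePoint ℂ) := by
  have hI : I = exp (Real.pi * I / 4) * exp (Real.pi * I / 4) := by
    rw [← Complex.exp_add, show Real.pi * I / 4 + Real.pi * I / 4 = Real.pi / 2 * I by ring,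
      Complex.exp_pi_div_two_mul_I]
  rw [PSU2.mk_smul_coe, matT_val]
  simp only [Matrix.of_apply, Matrix.cons_val', Matrix.cons_val_zero, Matrix.cons_val_one,
    Matrix.cons_val_fin_one, add_zero, zero_mul, zero_add]
  rw [if_neg (exp_ne_zero _), Complex.exp_neg, div_inv_eq_mul]
  nth_rewrite 3 [hI]
  congr 1
  ring

theorem matT_smul_infty : PSU2.mk matT • (OnePoint.infty : OnePoint ℂ) = OnePoint.infty := by
  rw [PSU2.mk_smul_infty, matT_val]
  simp

theorem matS_smul_coe {w : ℂ} (hw : 1 + w ≠ 0) :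
    PSU2.mk matS • (w : OnePoint ℂ) = (((1 - w) / (1 + w) : ℂ) : OnePoint ℂ) := by
  have h2 : ((√2 : ℝ) : ℂ) ≠ 0 := by simp
  have hc : I / ((√2 : ℝ) : ℂ) ≠ 0 := div_ne_zero I_ne_zero h2
  rw [PSU2.mk_smul_coe, matS_val]
  simp only [Matrix.smul_apply, Matrix.of_apply, Matrix.cons_val', Matrix.cons_val_zero,
    Matrix.cons_val_one, Matrix.cons_val_fin_one, smul_eq_mul, mul_one]
  have h : I / ((√2 : ℝ) : ℂ) * w + I / ((√2 : ℝ) : ℂ) = I / ((√2 : ℝ) : ℂ) * (1 + w) := by ring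
  rw [h, if_neg (mul_ne_zero hc hw)]
  congr 1
  rw [div_eq_div_iff (mul_ne_zero hc hw) hw]
  ring

theorem matS_smul_neg_one :
    PSU2.mk matS • ((-1 : ℂ) : OnePoint ℂ) = OnePoint.infty := by
  rw [PSU2.mk_smul_coe, matS_val]
  simp

theorem matS_smul_infty :
    PSU2.mk matS • (OnePoint.infty : OnePoint ℂ) = ((-1 : ℂ) : OnePoint ℂ) := by
  rw [PSU2.mk_smul_infty, matS_val]
  simp

theorem matT_mul_kA : PSU2.mk matT * kA = kA * PSU2.mk matT := by
  apply PSU2.eq_of_agree <;>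
    simp [mul_smul, matT_smul_coe, matT_smul_infty, kA_smul_coe, kA_smul_infty]

theorem matT_mul_kB : PSU2.mk matT * kB = kC * PSU2.mk matT := by
  rw [← kA_mul_kB]
  apply PSU2.eq_of_agree <;>
    simp only [mul_smul, matT_smul_coe, matT_smul_infty, kA_smul_coe, kA_smul_infty, kB_smul_zero,
      kB_smul_infty, kB_smul_coe one_ne_zero, mul_zero, neg_zero, mul_one, inv_one,
      kB_smul_coe I_ne_zero, inv_I, neg_neg]

theorem matS_mul_kA : PSU2.mk matS * kA = kB * PSU2.mk matS := by
  apply PSU2.eq_of_agree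
  · rw [mul_smul, mul_smul, kA_smul_coe, neg_zero, matS_smul_coe (by simp),
      kB_smul_coe (by simp)]
    simp
  · rw [mul_smul, mul_smul, kA_smul_coe, matS_smul_neg_one, matS_smul_coe (by norm_num), sub_self,
      zero_div, kB_smul_zero]
  · rw [mul_smul, mul_smul, kA_smul_infty, matS_smul_infty, kB_smul_coe (by simp)]
    norm_num

theorem matS_mul_kB : PSU2.mk matS * kB = kA * PSU2.mk matS := by
  apply PSU2.eq_of_agree
  · rw [mul_smul, mul_smul, kB_smul_zero, matS_smul_infty, matS_smul_coe (by simp), kA_smul_coe]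
    simp
  · rw [mul_smul, mul_smul, kB_smul_coe one_ne_zero, inv_one, matS_smul_coe (by norm_num), sub_self,
      zero_div, kA_smul_coe, neg_zero]
  · rw [mul_smul, mul_smul, kB_smul_infty, matS_smul_infty, matS_smul_coe (by simp), kA_smul_coe]
    simp

theorem matT_sq : PSU2.mk matT * PSU2.mk matT = kA := by
  apply PSU2.eq_of_agree <;>
    simp [mul_smul, matT_smul_coe, matT_smul_infty, kA_smul_coe, kA_smul_infty]

/-- Since `K₄` is finite, conjugation by `g` only has to map it into itself, and `kA`, `kB` generate
it. -/
theorem mem_NK4_of_conj {g a b : PSU2} (ha : a ∈ K4) (hb : b ∈ K4) (hA : g * kA = a * g)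
    (hB : g * kB = b * g) : g ∈ NK4 := by
  have hfin : Finite (K4 : Set PSU2) := by
    change Finite ({1, kA, kB, kC} : Set PSU2)
    infer_instance
  refine Subgroup.mem_normalizer_fintype ?_
  rintro x (rfl | rfl | rfl | rfl)
  · rw [mul_one, mul_inv_cancel]; exact K4.one_mem
  · rw [hA, mul_inv_cancel_right]; exact ha
  · rw [hB, mul_inv_cancel_right]; exact hb
  · change g * kC * g⁻¹ ∈ K4
    rw [← kA_mul_kB, ← mul_assoc, hA, mul_assoc a, hB, ← mul_assoc, mul_inv_cancel_right]
    exact K4.mul_mem ha hb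

theorem matT_mem : PSU2.mk matT ∈ NK4 := mem_NK4_of_conj kA_mem kC_mem matT_mul_kA matT_mul_kB

theorem matS_mem : PSU2.mk matS ∈ NK4 := mem_NK4_of_conj kB_mem kA_mem matS_mul_kA matS_mul_kB

/-- `N(K₄)` is generated by the classes of `matT` and `matS`. -/
theorem NK4_le {H : Subgroup PSU2} (hT : PSU2.mk matT ∈ H) (hS : PSU2.mk matS ∈ H) :
    NK4 ≤ H := by
  have hAH : kA ∈ H := matT_sq ▸ H.mul_mem hT hT
  have hBH : kB ∈ H := by
    rw [← mul_inv_cancel_right kB (PSU2.mk matS), ← matS_mul_kA]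
    exact H.mul_mem (H.mul_mem hS hAH) (H.inv_mem hS)
  have hK : K4 ≤ H := by
    rintro x (rfl | rfl | rfl | rfl)
    · exact H.one_mem
    · exact hAH
    · exact hBH
    · rw [show PSU2.mk kleinC = kA * kB from kA_mul_kB.symm]
      exact H.mul_mem hAH hBH
  have conj_mem : ∀ g ∈ NK4, ∀ x ∈ K4, ∃ y ∈ K4, g * x = y * g := fun g hg x hx =>
    ⟨g * x * g⁻¹, (Subgroup.mem_normalizer_iff.1 hg x).1 hx, by simp⟩
  have inj : ∀ (g : PSU2) {x y z : PSU2}, g * x = z * g → g * y = z * g → x = y :=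
    fun g x y z h1 h2 => mul_left_cancel (h1.trans h2.symm)
  -- If `g` centralizes `kA`, it fixes or exchanges `kB` and `kC`. `matT` exchanges them, so `g` or
  -- `matT * g` centralizes `K₄` and hence lies in it.
  have step1 : ∀ g : PSU2, g ∈ NK4 → g * kA = kA * g → g ∈ H := by
    intro g hg hA
    obtain ⟨y, hy, hB⟩ := conj_mem g hg kB kB_mem
    rcases mem_K4_iff.1 hy with rfl | rfl | rfl | rfl
    · rw [one_mul] at hB
      exact absurd (mul_eq_left.1 hB) kB_ne_one
    · exact absurd (inj g hA hB) kA_ne_kB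
    · exact hK (mem_K4_of_commute hA hB)
    · have hTC : PSU2.mk matT * kC = kB * PSU2.mk matT := by
        rw [← kA_mul_kB, ← mul_assoc, matT_mul_kA, mul_assoc, matT_mul_kB, ← mul_assoc,
          ← kA_mul_kB, ← mul_assoc, kA_mul_kA, one_mul]
      have : PSU2.mk matT * g ∈ K4 := by
        apply mem_K4_of_commute
        · rw [mul_assoc, hA, ← mul_assoc, matT_mul_kA, mul_assoc]
        · rw [mul_assoc, hB, ← mul_assoc, hTC, mul_assoc]
      exact (H.mul_mem_cancel_left hT).1 (hK this)
  -- `matS` exchanges `kA` and `kB`, so `matS * g` centralizes `kA`.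
  have step2 : ∀ g : PSU2, g ∈ NK4 → g * kA = kB * g → g ∈ H := by
    intro g hg hA
    refine (H.mul_mem_cancel_left hS).1 (step1 _ (NK4.mul_mem matS_mem hg) ?_)
    rw [mul_assoc, hA, ← mul_assoc, matS_mul_kB, mul_assoc]
  intro g hg
  obtain ⟨y, hy, hA⟩ := conj_mem g hg kA kA_mem
  rcases mem_K4_iff.1 hy with rfl | rfl | rfl | rfl
  · rw [one_mul] at hA
    exact absurd (mul_eq_left.1 hA) kA_ne_one
  · exact step1 g hg hA
  · exact step2 g hg hA
  -- Here `g` conjugates `kA` to `kC`, and `matT` carries `kC` on to `kB`.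
  · have hTC : PSU2.mk matT * kC = kB * PSU2.mk matT := by
      rw [← kA_mul_kB, ← mul_assoc, matT_mul_kA, mul_assoc, matT_mul_kB, ← mul_assoc,
        ← kA_mul_kB, ← mul_assoc, kA_mul_kA, one_mul]
    refine (H.mul_mem_cancel_left hT).1 (step2 _ (NK4.mul_mem matT_mem hg) ?_)
    rw [mul_assoc, hA, ← mul_assoc, hTC, mul_assoc]

theorem exists_mulEquiv_of_ker_eq {G H K : Type*} [Group G] [Group H] [Group K] (f : G →* H)
    (g : G →* K) (hf : Function.Surjective f) (hg : Function.Surjective g) (h : f.ker = g.ker) :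
    ∃ e : H ≃* K, ∀ x, e (f x) = g x := by
  refine ⟨((QuotientGroup.quotientKerEquivOfSurjective f hf).symm.trans
    (QuotientGroup.quotientMulEquivOfEq h)).trans
    (QuotientGroup.quotientKerEquivOfSurjective g hg), fun x => ?_⟩
  have : (QuotientGroup.quotientKerEquivOfSurjective f hf).symm (f x) = QuotientGroup.mk x := by
    rw [MulEquiv.symm_apply_eq]
    rfl
  rw [MulEquiv.trans_apply, MulEquiv.trans_apply, this]
  rfl

/-! ### `SL₂(ℤ/4ℤ)` and binary quadratic forms -/

/-- The sign-normalized binary quadratic forms `a x² + x y + c y²` over `ℤ/4ℤ` with `a` and `c`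
units. -/
abbrev UnitForm : Type := {u : ZMod 4 × ZMod 4 // u.1 * u.1 = 1 ∧ u.2 * u.2 = 1}

/-- The coefficient of `x y` in the form `u` transformed by `(p, q; r, s)`. -/
def midCoeff (p q r s : ZMod 4) (u : ZMod 4 × ZMod 4) : ZMod 4 :=
  2 * p * q * u.1 + (p * s + q * r) + 2 * r * s * u.2

/-- The form `u` transformed by `(p, q; r, s)`, normalized to have `x y` coefficient `1`. -/
def formAct (p q r s : ZMod 4) (u : ZMod 4 × ZMod 4) : ZMod 4 × ZMod 4 :=
  ((p * p * u.1 + p * r + r * r * u.2) * midCoeff p q r s u,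
    (q * q * u.1 + q * s + s * s * u.2) * midCoeff p q r s u)

/-- Modulo `2` the coefficient is `ps + qr = ps - qr = 1`, and odd residues square to `1` modulo
`4`. Being its own inverse, it can be normalized away by multiplication, as `formAct` does. -/
theorem midCoeff_sq : ∀ p q r s : ZMod 4, p * s - q * r = 1 → ∀ u : ZMod 4 × ZMod 4,
    midCoeff p q r s u * midCoeff p q r s u = 1 := by
  intro p q r s h u
  have h4 : (4 : ZMod 4) = 0 := rfl
  have h1 : ∀ x : ZMod 4, 2 * (x * (x + 1)) = 0 := by decide
  unfold midCoeff
  have e : p * s + q * r = 1 + 2 * (q * r) := by linear_combination h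
  rw [e]
  linear_combination 2 * h1 (q * r) + (p * q * u.1 + r * s * u.2) * (p * q * u.1 + r * s * u.2
    + 1 + 2 * q * r) * h4

/-- Modulo `2` a unit form is `x² + xy + y²`, which takes the value `1` at every nonzero vector; the
columns of a matrix of determinant `1` are nonzero modulo `2`. -/
theorem formAct_unit : ∀ p q r s : ZMod 4, p * s - q * r = 1 → ∀ u : ZMod 4 × ZMod 4,
    u.1 * u.1 = 1 ∧ u.2 * u.2 = 1 →
    (formAct p q r s u).1 * (formAct p q r s u).1 = 1 ∧
      (formAct p q r s u).2 * (formAct p q r s u).2 = 1 := by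
  intro p q r s h u hu
  have key : ∀ p q r s : ZMod 4, p * s - q * r = 1 → ∀ x y : ZMod 4, x * x = 1 → y * y = 1 →
      (p * p * x + p * r + r * r * y) * (p * p * x + p * r + r * r * y) = 1 := by decide
  have hm := midCoeff_sq p q r s h u
  have k1 := key p q r s h u.1 u.2 hu.1 hu.2
  -- The second column becomes a first column after multiplying by a quarter turn, which keeps the
  -- determinant.
  have k2 := key (-q) p (-s) r (by linear_combination h) u.1 u.2 hu.1 hu.2
  constructor
  · unfold formAct
    linear_combination midCoeff p q r s u * midCoeff p q r s u * k1 + hm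
  · unfold formAct
    linear_combination midCoeff p q r s u * midCoeff p q r s u * k2 + hm

/-- Substitution into a form is a right action, hence the inverse. The sign normalization is
compatible with composition because the middle coefficients form a multiplicative cocycle. -/
instance : MulAction SL(2, ZMod 4) UnitForm where
  smul g u := ⟨formAct (g⁻¹ 0 0) (g⁻¹ 0 1) (g⁻¹ 1 0) (g⁻¹ 1 1) u.1,
    formAct_unit _ _ _ _ ((Matrix.det_fin_two _).symm.trans g⁻¹.2) _ u.2⟩
  one_smul u := Subtype.ext <| by
    change formAct ((1 : SL(2, ZMod 4))⁻¹ 0 0) _ _ _ _ = _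
    simp [formAct, midCoeff]
  mul_smul g h u := Subtype.ext <| by
    change formAct ((g * h)⁻¹ 0 0) ((g * h)⁻¹ 0 1) ((g * h)⁻¹ 1 0) ((g * h)⁻¹ 1 1) u.1 =
      formAct (g⁻¹ 0 0) (g⁻¹ 0 1) (g⁻¹ 1 0) (g⁻¹ 1 1)
        (formAct (h⁻¹ 0 0) (h⁻¹ 0 1) (h⁻¹ 1 0) (h⁻¹ 1 1) u.1)
    have hm := midCoeff_sq _ _ _ _ ((Matrix.det_fin_two _).symm.trans h⁻¹.2) u.1
    rw [mul_inv_rev]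
    generalize h⁻¹ = h at hm ⊢
    generalize g⁻¹ = g
    generalize u.1 = u at hm ⊢
    simp only [Matrix.SpecialLinearGroup.coe_mul, Matrix.mul_apply, Fin.sum_univ_two]
    generalize h 0 0 = p at hm ⊢
    generalize h 0 1 = q at hm ⊢
    generalize h 1 0 = r at hm ⊢
    generalize h 1 1 = s at hm ⊢
    generalize hmu : midCoeff p q r s u = m at hm
    -- The cocycle identity. The factor `m` on the left undoes the normalization of the intermediate
    -- form, by `m * m = 1`.
    have hm' : midCoeff (g 0 0) (g 0 1) (g 1 0) (g 1 1) (formAct p q r s u) * m =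
        midCoeff (p * g 0 0 + q * g 1 0) (p * g 0 1 + q * g 1 1)
        (r * g 0 0 + s * g 1 0) (r * g 0 1 + s * g 1 1) u := by
      unfold formAct
      rw [hmu]
      unfold midCoeff at hmu ⊢
      linear_combination (2 * g 0 0 * g 0 1 * (p * p * u.1 + p * r + r * r * u.2) +
        2 * g 1 0 * g 1 1 * (q * q * u.1 + q * s + s * s * u.2)) * hm
        - (g 0 0 * g 1 1 + g 0 1 * g 1 0) * hmu
    have e1 : (formAct p q r s u).1 = (p * p * u.1 + p * r + r * r * u.2) * m := by
      rw [← hmu]; rfl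
    have e2 : (formAct p q r s u).2 = (q * q * u.1 + q * s + s * s * u.2) * m := by
      rw [← hmu]; rfl
    rw [formAct, ← hm']
    refine Eq.trans ?_ (show _ = ((g 0 0 * g 0 0 * (formAct p q r s u).1 + g 0 0 * g 1 0 +
        g 1 0 * g 1 0 * (formAct p q r s u).2) *
        midCoeff (g 0 0) (g 0 1) (g 1 0) (g 1 1) (formAct p q r s u),
      (g 0 1 * g 0 1 * (formAct p q r s u).1 + g 0 1 * g 1 1 +
        g 1 1 * g 1 1 * (formAct p q r s u).2) *
        midCoeff (g 0 0) (g 0 1) (g 1 0) (g 1 1) (formAct p q r s u)) from rfl)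
    rw [e1, e2]
    generalize midCoeff (g 0 0) (g 0 1) (g 1 0) (g 1 1) (formAct p q r s u) = m'
    unfold midCoeff at hmu
    refine Prod.ext ?_ ?_
    · linear_combination (g 0 0 * g 1 0 * m' * m) * hmu + (g 0 0 * g 1 0 * m') * hm
    · linear_combination (g 0 1 * g 1 1 * m' * m) * hmu + (g 0 1 * g 1 1 * m') * hm

/-- Three forms suffice: a permutation of the four unit forms that fixes three of them fixes the
fourth. -/
theorem formAct_faithful : ∀ p q r s : ZMod 4, p * s - q * r = 1 →
    formAct p q r s (1, 1) = (1, 1) → formAct p q r s (1, -1) = (1, -1) →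
    formAct p q r s (-1, 1) = (-1, 1) →
    (p = 1 ∧ q = 0 ∧ r = 0 ∧ s = 1) ∨ (p = -1 ∧ q = 0 ∧ r = 0 ∧ s = -1) := by
  decide

theorem toPermHom_unitForm_ker :
    (MulAction.toPermHom SL(2, ZMod 4) UnitForm).ker = Subgroup.zpowers (-1) := by
  apply le_antisymm
  · intro g hg
    rw [← inv_mem_iff (x := g)] at hg ⊢
    have hact : ∀ u : UnitForm, formAct (g 0 0) (g 0 1) (g 1 0) (g 1 1) u.1 = u.1 := fun u => by
      have := congrArg Subtype.val (Equiv.congr_fun (MonoidHom.mem_ker.1 hg) u)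
      change formAct (g⁻¹⁻¹ 0 0) (g⁻¹⁻¹ 0 1) (g⁻¹⁻¹ 1 0) (g⁻¹⁻¹ 1 1) u.1 = u.1 at this
      rwa [inv_inv] at this
    refine (inv_mem_iff (x := g)).2 ?_
    rcases formAct_faithful _ _ _ _ ((Matrix.det_fin_two _).symm.trans g.2)
      (hact ⟨(1, 1), by decide⟩) (hact ⟨(1, -1), by decide⟩) (hact ⟨(-1, 1), by decide⟩) with
      ⟨h1, h2, h3, h4⟩ | ⟨h1, h2, h3, h4⟩
    · have : g = 1 := by
        ext i j
        fin_cases i <;> fin_cases j <;> simp [h1, h2, h3, h4]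
      rw [this]
      exact Subgroup.one_mem _
    · have : g = -1 := by
        ext i j
        fin_cases i <;> fin_cases j <;> simp [h1, h2, h3, h4]
      rw [this]
      exact Subgroup.mem_zpowers _
  · rw [Subgroup.zpowers_le]
    refine MonoidHom.mem_ker.2 (Equiv.ext fun u => Subtype.ext ?_)
    change formAct ((-1 : SL(2, ZMod 4))⁻¹ 0 0) ((-1 : SL(2, ZMod 4))⁻¹ 0 1)
      ((-1 : SL(2, ZMod 4))⁻¹ 1 0) ((-1 : SL(2, ZMod 4))⁻¹ 1 1) u.1 = u.1
    rw [show (-1 : SL(2, ZMod 4))⁻¹ = -1 from inv_eq_of_mul_eq_one_left (by simp)]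
    simp [formAct, midCoeff]

theorem card_unitForm : Fintype.card UnitForm = 4 := by decide

/-! ### Reduction of `SL₂(ℤ)` -/

/-- The matrix `(1, x; 0, 1)`. -/
def shear {R : Type*} [CommRing R] (x : R) : SL(2, R) := ⟨!![1, x; 0, 1], by simp⟩

/-- The matrix `(0, -1; 1, 0)`. -/
def quarterTurn (R : Type*) [CommRing R] : SL(2, R) := ⟨!![0, -1; 1, 0], by simp⟩

theorem shear_val {R : Type*} [CommRing R] (x : R) :
    (shear x : Matrix (Fin 2) (Fin 2) R) = !![1, x; 0, 1] := rfl

theorem quarterTurn_val (R : Type*) [CommRing R] :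
    (quarterTurn R : Matrix (Fin 2) (Fin 2) R) = !![0, -1; 1, 0] := rfl

/-- If each unimodular first column over `ℤ/N` has an entry `± 1`, then `SL₂(ℤ/N)` is generated by
the shears and the quarter turn. -/
theorem SL2_mem_of_generators {N : ℕ} (hN : ∀ p r : ZMod N, (∃ q s, p * s - q * r = 1) →
      (r = 1 ∨ r = -1 ∨ p = 1 ∨ p = -1)) (H : Subgroup SL(2, ZMod N))
    (hT : ∀ x : ZMod N, shear x ∈ H) (hS : quarterTurn (ZMod N) ∈ H) (g : SL(2, ZMod N)) :
    g ∈ H := by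
  have hSS : (-1 : SL(2, ZMod N)) ∈ H := by
    have h : quarterTurn (ZMod N) * quarterTurn (ZMod N) = -1 := by
      ext i j
      fin_cases i <;> fin_cases j <;>
        simp [Matrix.mul_apply, Fin.sum_univ_two, quarterTurn_val]
    rw [← h]
    exact H.mul_mem hS hS
  have key1 : ∀ g : SL(2, ZMod N), g 1 0 = 1 → g ∈ H := by
    intro g hg
    have hdet := (Matrix.det_fin_two _).symm.trans g.2
    -- Bruhat decomposition of the big cell with lower left entry `1`.
    have : g = shear (g 0 0) * quarterTurn _ * shear (g 1 1) := by
      ext i j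
      fin_cases i <;> fin_cases j <;>
        simp [Matrix.mul_apply, Fin.sum_univ_two, hg, quarterTurn_val, shear_val]
      linear_combination -hdet - g.1 0 1 * hg
    rw [this]
    exact H.mul_mem (H.mul_mem (hT _) hS) (hT _)
  have key2 : ∀ g : SL(2, ZMod N), g 1 0 = 1 ∨ g 1 0 = -1 → g ∈ H := by
    rintro g (hg | hg)
    · exact key1 g hg
    · rw [← neg_neg g, ← neg_one_mul]
      exact H.mul_mem hSS (key1 _ (by simp [hg]))
  rcases hN (g 0 0) (g 1 0) ⟨g 0 1, g 1 1, (Matrix.det_fin_two _).symm.trans g.2⟩ with h | h | h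
  · exact key2 g (Or.inl h)
  · exact key2 g (Or.inr h)
  -- Left multiplication by the quarter turn moves the upper left entry to the lower left corner.
  · refine (H.mul_mem_cancel_left hS).1 (key2 _ ?_)
    simpa [Matrix.mul_apply, Fin.sum_univ_two, quarterTurn_val] using h

/-- The generating shears and quarter turn visibly lift to `ℤ`. -/
theorem SL2_map_surjective {N : ℕ} (hN : ∀ p r : ZMod N, (∃ q s, p * s - q * r = 1) →
      (r = 1 ∨ r = -1 ∨ p = 1 ∨ p = -1)) :
    Function.Surjective (Matrix.SpecialLinearGroup.map (n := Fin 2) (Int.castRingHom (ZMod N))) := by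
  rw [← MonoidHom.range_eq_top, eq_top_iff]
  intro g _
  refine SL2_mem_of_generators hN _ (fun x => ?_) ?_ g
  · obtain ⟨n, rfl⟩ := ZMod.intCast_surjective x
    refine ⟨shear n, ?_⟩
    ext i j
    fin_cases i <;> fin_cases j <;> simp [shear_val]
  · refine ⟨quarterTurn ℤ, ?_⟩
    ext i j
    fin_cases i <;> fin_cases j <;> simp [quarterTurn_val]

theorem SL2_map_four_surjective : Function.Surjective
    (Matrix.SpecialLinearGroup.map (n := Fin 2) (Int.castRingHom (ZMod 4))) :=
  SL2_map_surjective (by decide)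

theorem SL2_map_two_surjective : Function.Surjective
    (Matrix.SpecialLinearGroup.map (n := Fin 2) (Int.castRingHom (ZMod 2))) :=
  SL2_map_surjective (by decide)

/-- The nonzero vectors of the plane over `𝔽₂`. -/
abbrev NonzeroVec : Type := {v : Fin 2 → ZMod 2 // v ≠ 0}

instance : MulAction SL(2, ZMod 2) NonzeroVec where
  smul g v := ⟨g.1.mulVec v.1, fun h => v.2 (by
    have : (g⁻¹).1.mulVec (g.1.mulVec v.1) = v.1 := by
      rw [Matrix.mulVec_mulVec, ← Matrix.SpecialLinearGroup.coe_mul, inv_mul_cancel,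
        Matrix.SpecialLinearGroup.coe_one, Matrix.one_mulVec]
    rw [← this, h, Matrix.mulVec_zero])⟩
  one_smul v := Subtype.ext (Matrix.one_mulVec v.1)
  mul_smul g h v := Subtype.ext (Matrix.mulVec_mulVec v.1 g.1 h.1).symm

theorem card_SL2_two : Nat.card SL(2, ZMod 2) = 6 := by
  rw [Nat.card_eq_fintype_card]
  decide

/-- The action on the three nonzero vectors is faithful, and both groups have order `6`. -/
theorem SL2_two_equiv_perm : Nonempty (SL(2, ZMod 2) ≃* Equiv.Perm (Fin 3)) := by
  have hinj : Function.Injective (MulAction.toPermHom SL(2, ZMod 2) NonzeroVec) := by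
    rw [injective_iff_map_eq_one]
    intro g hg
    have hact : ∀ v : NonzeroVec, g.1.mulVec v.1 = v.1 := fun v =>
      congrArg Subtype.val (Equiv.congr_fun hg v)
    have h0 := hact ⟨![1, 0], by decide⟩
    have h1 := hact ⟨![0, 1], by decide⟩
    ext i j
    have h0 := congrFun h0 i
    have h1 := congrFun h1 i
    fin_cases i <;> fin_cases j <;> simp_all [Matrix.mulVec, dotProduct, Fin.sum_univ_two]
  have hcard : Fintype.card NonzeroVec = 3 := by decide
  have hbij := hinj.bijective_of_nat_card_le (by
    rw [card_SL2_two, Nat.card_eq_fintype_card, Fintype.card_perm, hcard]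
    decide)
  exact ⟨(MulEquiv.ofBijective _ hbij).trans (Fintype.equivFinOfCardEq hcard).permCongrHom⟩

/-! ### Parities of exponents in `K₄` and congruence conditions on `γ`. -/

theorem card_K4 : Nat.card K4 = 4 := by
  have : (K4 : Set PSU2) = {1, kA, kB, kC} := rfl
  rw [← SetLike.coe_sort_coe, this, Nat.card_coe_set_eq, Set.ncard_insert_of_notMem,
    Set.ncard_insert_of_notMem, Set.ncard_pair kC_ne_kB.symm]
  · simp [kA_ne_kB, kC_ne_kA.symm]
  · simp [kA_ne_one.symm, kB_ne_one.symm, kC_ne_one.symm]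

theorem zpow_of_mul_self {G : Type*} [Group G] {x : G} (hx : x * x = 1) (n : ℤ) :
    x ^ n = if Even n then 1 else x := by
  have h2 : ∀ k : ℤ, x ^ (2 * k) = 1 := fun k => by
    rw [zpow_mul, zpow_two, hx, one_zpow]
  split_ifs with h
  · obtain ⟨k, rfl⟩ := h
    rw [← two_mul, h2]
  · obtain ⟨k, rfl⟩ := Int.not_even_iff_odd.1 h
    rw [zpow_add, h2, one_mul, zpow_one]

/-- This and its companion for `kB` turn the statement that conjugation by `ψ(γ)` fixes `kA` and
`kB` into the congruences defining `Γ(2)`. -/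
theorem klein_eq_kA_iff (m n : ℤ) : kA ^ m * kB ^ n = kA ↔ Odd m ∧ Even n := by
  rw [zpow_of_mul_self kA_mul_kA, zpow_of_mul_self kB_mul_kB, ← Int.not_even_iff_odd]
  have h : kA * kB ≠ kA := mul_eq_left.not.2 kB_ne_one
  by_cases hm : Even m <;> by_cases hn : Even n <;>
    simp [hm, hn, kA_ne_one.symm, kA_ne_kB.symm, h]

theorem klein_eq_kB_iff (m n : ℤ) : kA ^ m * kB ^ n = kB ↔ Even m ∧ Odd n := by
  rw [zpow_of_mul_self kA_mul_kA, zpow_of_mul_self kB_mul_kB, ← Int.not_even_iff_odd]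
  have h : kA * kB ≠ kB := mul_eq_right.not.2 kA_ne_one
  by_cases hm : Even m <;> by_cases hn : Even n <;>
    simp [hm, hn, kB_ne_one.symm, kA_ne_kB, h]

theorem mem_Gamma_two_iff (γ : SL(2, ℤ)) : γ ∈ CongruenceSubgroup.Gamma 2 ↔
    (Odd (γ 1 1) ∧ Even (γ 1 0)) ∧ (Even (γ 0 1) ∧ Odd (γ 0 0)) := by
  have hodd : ∀ n : ℤ, ((n : ZMod 2) = 1) ↔ Odd n := fun n => by
    rw [← ZMod.intCast_eq_one_iff_odd]
  have heven : ∀ n : ℤ, ((n : ZMod 2) = 0) ↔ Even n := fun n => by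
    rw [← ZMod.intCast_eq_zero_iff_even]
  rw [CongruenceSubgroup.Gamma_mem, hodd, hodd, heven, heven]
  tauto

/-- Once `4` divides both off-diagonal entries, the determinant gives `ad = 1` modulo `4`, which
forces `a = d = ±1`. -/
theorem map_four_mem_zpowers_iff (γ : SL(2, ℤ)) :
    Matrix.SpecialLinearGroup.map (Int.castRingHom (ZMod 4)) γ ∈
      Subgroup.zpowers (-1 : SL(2, ZMod 4)) ↔
    γ ∈ CongruenceSubgroup.Gamma 2 ∧ (4 : ℤ) ∣ γ 0 1 ∧ (4 : ℤ) ∣ γ 1 0 := by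
  have hdvd : ∀ n : ℤ, (4 : ℤ) ∣ n ↔ (n : ZMod 4) = 0 := fun n =>
    (ZMod.intCast_zmod_eq_zero_iff_dvd n 4).symm
  have hdet : ((γ 0 0 : ℤ) : ZMod 4) * (γ 1 1 : ℤ) - (γ 0 1 : ℤ) * (γ 1 0 : ℤ) = 1 := by
    have := (Matrix.det_fin_two γ.1).symm.trans γ.2
    exact_mod_cast congrArg (Int.cast : ℤ → ZMod 4) this
  have hodd : ∀ n : ℤ, (n : ZMod 4) = 1 ∨ (n : ZMod 4) = -1 → Odd n := by
    intro n hn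
    rw [← Int.not_even_iff_odd]
    rintro ⟨k, rfl⟩
    push_cast at hn
    revert hn
    generalize (k : ZMod 4) = y
    revert y
    decide
  have heven : ∀ n : ℤ, (4 : ℤ) ∣ n → Even n := fun n ⟨k, hk⟩ => ⟨2 * k, by omega⟩
  constructor
  · rintro h
    have hcases : Matrix.SpecialLinearGroup.map (Int.castRingHom (ZMod 4)) γ = 1 ∨
        Matrix.SpecialLinearGroup.map (Int.castRingHom (ZMod 4)) γ = -1 := by
      obtain ⟨n, hn⟩ := Subgroup.mem_zpowers_iff.1 h
      rw [zpow_of_mul_self (by simp)] at hn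
      split_ifs at hn
      · exact Or.inl hn.symm
      · exact Or.inr hn.symm
    have hij : ∀ i j, Matrix.SpecialLinearGroup.map (Int.castRingHom (ZMod 4)) γ i j =
      ((γ i j : ℤ) : ZMod 4) := fun i j => rfl
    have h00 := hij 0 0
    have h01 := hij 0 1
    have h10 := hij 1 0
    have h11 := hij 1 1
    rcases hcases with h | h <;> rw [h] at h00 h01 h10 h11 <;> simp at h00 h01 h10 h11 <;>
      refine ⟨(mem_Gamma_two_iff γ).2 ⟨⟨hodd _ ?_, heven _ ?_⟩, heven _ ?_, hodd _ ?_⟩, ?_, ?_⟩ <;>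
      simp [hdvd, ← h00, ← h01, ← h10, ← h11]
  · rintro ⟨-, hb, hc⟩
    rw [hdvd] at hb hc
    rw [hb, hc] at hdet
    have key : ∀ a d : ZMod 4, a * d - 0 * 0 = 1 → (a = 1 ∧ d = 1) ∨ (a = -1 ∧ d = -1) := by decide
    rcases key _ _ hdet with ⟨ha, hd⟩ | ⟨ha, hd⟩
    · have : Matrix.SpecialLinearGroup.map (Int.castRingHom (ZMod 4)) γ = 1 := by
        ext i j
        fin_cases i <;> fin_cases j <;> simp [ha, hb, hc, hd]
      rw [this]
      exact Subgroup.one_mem _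
    · have : Matrix.SpecialLinearGroup.map (Int.castRingHom (ZMod 4)) γ = -1 := by
        ext i j
        fin_cases i <;> fin_cases j <;> simp [ha, hb, hc, hd]
      rw [this]
      exact Subgroup.mem_zpowers _

theorem comap_zpowers_neg_one :
    (Subgroup.zpowers (-1 : SL(2, ZMod 4))).comap
      (Matrix.SpecialLinearGroup.map (Int.castRingHom (ZMod 4))) =
    Subgroup.closure {(-1 : SL(2, ℤ))} ⊔ CongruenceSubgroup.Gamma 4 := by
  have hm : Matrix.SpecialLinearGroup.map (Int.castRingHom (ZMod 4)) (-1 : SL(2, ℤ)) = -1 := by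
    ext i j
    fin_cases i <;> fin_cases j <;> simp
  rw [← Subgroup.zpowers_eq_closure, ← hm, ← MonoidHom.map_zpowers, Subgroup.comap_map_eq]
  rfl

/-! ### Group-theoretic consequences of the properties of `ψ`. -/

section PsiConsequences

variable (ψ : SL(2, ℤ) →* NK4)

theorem psi_surjective (hT : (ψ ⟨!![1, 1; 0, 1], by simp⟩ : PSU2) = PSU2.mk matT)
    (hS : (ψ ⟨!![0, 1; -1, 0], by simp⟩ : PSU2) = PSU2.mk matS) : Function.Surjective ψ := by
  intro x
  have h := NK4_le (H := ψ.range.map NK4.subtype) ⟨_, ⟨_, rfl⟩, hT⟩ ⟨_, ⟨_, rfl⟩, hS⟩ x.2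
  obtain ⟨y, ⟨γ, rfl⟩, hy⟩ := h
  exact ⟨γ, Subtype.ext hy⟩

/-- `ψ γ` lies in the self-centralizing group `K₄` exactly when it commutes with `kA` and `kB`,
which the two hypotheses express by the parities of the rows of `γ`. -/
theorem psi_comap_K4
    (hA : ∀ γ, kA * (ψ γ : PSU2) = ψ γ * (kA ^ (γ 1 1) * kB ^ (γ 1 0)))
    (hB : ∀ γ, kB * (ψ γ : PSU2) = ψ γ * (kA ^ (γ 0 1) * kB ^ (γ 0 0))) :
    (K4.subgroupOf NK4).comap ψ = CongruenceSubgroup.Gamma 2 := by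
  ext γ
  rw [Subgroup.mem_comap, Subgroup.mem_subgroupOf, mem_Gamma_two_iff, ← klein_eq_kA_iff,
    ← klein_eq_kB_iff]
  constructor
  · intro h
    constructor
    · exact (mul_left_cancel ((K4_comm h kA_mem).trans (hA γ))).symm
    · exact (mul_left_cancel ((K4_comm h kB_mem).trans (hB γ))).symm
  · rintro ⟨h1, h2⟩
    apply mem_K4_of_commute
    · have := hA γ
      rw [h1] at this
      exact this.symm
    · have := hB γ
      rw [h2] at this
      exact this.symm

variable {ψ}

theorem psi_ker_eq (hK : (K4.subgroupOf NK4).comap ψ = CongruenceSubgroup.Gamma 2)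
    (hker : ∀ γ ∈ CongruenceSubgroup.Gamma 2, ψ γ = 1 ↔ (4 : ℤ) ∣ γ 0 1 ∧ (4 : ℤ) ∣ γ 1 0) :
    ψ.ker = (Subgroup.zpowers (-1 : SL(2, ZMod 4))).comap
      (Matrix.SpecialLinearGroup.map (Int.castRingHom (ZMod 4))) := by
  ext γ
  rw [Subgroup.mem_comap, map_four_mem_zpowers_iff, MonoidHom.mem_ker]
  constructor
  · intro h
    have h2 : γ ∈ CongruenceSubgroup.Gamma 2 := by
      rw [← hK, Subgroup.mem_comap, h]
      exact Subgroup.one_mem _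
    exact ⟨h2, (hker γ h2).1 h⟩
  · rintro ⟨h2, h⟩
    exact (hker γ h2).2 h

theorem exists_equiv_mod_four (hsurj : Function.Surjective ψ)
    (hker : ψ.ker = (Subgroup.zpowers (-1 : SL(2, ZMod 4))).comap
      (Matrix.SpecialLinearGroup.map (Int.castRingHom (ZMod 4)))) :
    ∃ e : SL(2, ZMod 4) ⧸ Subgroup.zpowers (-1 : SL(2, ZMod 4)) ≃* NK4, ∀ γ : SL(2, ℤ),
      e (QuotientGroup.mk (Matrix.SpecialLinearGroup.map (Int.castRingHom (ZMod 4)) γ)) = ψ γ := by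
  refine exists_mulEquiv_of_ker_eq ((QuotientGroup.mk' _).comp
    (Matrix.SpecialLinearGroup.map (Int.castRingHom (ZMod 4)))) ψ
    ((QuotientGroup.mk'_surjective _).comp SL2_map_four_surjective) hsurj ?_
  rw [hker, ← MonoidHom.comap_ker, QuotientGroup.ker_mk']

theorem exists_equiv_mod_two (hsurj : Function.Surjective ψ)
    (hK : (K4.subgroupOf NK4).comap ψ = CongruenceSubgroup.Gamma 2) :
    ∃ e : SL(2, ZMod 2) ≃* NK4 ⧸ K4.subgroupOf NK4, ∀ γ : SL(2, ℤ),
      e (Matrix.SpecialLinearGroup.map (Int.castRingHom (ZMod 2)) γ) =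
        QuotientGroup.mk (ψ γ) := by
  refine exists_mulEquiv_of_ker_eq (Matrix.SpecialLinearGroup.map (Int.castRingHom (ZMod 2)))
    ((QuotientGroup.mk' _).comp ψ) SL2_map_two_surjective
    ((QuotientGroup.mk'_surjective _).comp hsurj) ?_
  rw [← MonoidHom.comap_ker, QuotientGroup.ker_mk', hK]
  rfl

/-- The order is `6 · 4 = 24` by the chain `K₄ ⊂ N(K₄)`. The action of `SL₂(ℤ/4)/{±1}` on the four
unit forms embeds the group into `S₄`, so the embedding is bijective. -/
theorem NK4_equiv_perm (e : SL(2, ZMod 4) ⧸ Subgroup.zpowers (-1 : SL(2, ZMod 4)) ≃* NK4)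
    (e' : SL(2, ZMod 2) ≃* NK4 ⧸ K4.subgroupOf NK4) : Nonempty (NK4 ≃* Equiv.Perm (Fin 4)) := by
  have hcard : Nat.card NK4 = 24 := by
    rw [Subgroup.card_eq_card_quotient_mul_card_subgroup (K4.subgroupOf NK4),
      ← Nat.card_congr e'.toEquiv, card_SL2_two,
      Nat.card_congr (Subgroup.subgroupOfEquivOfLe Subgroup.le_normalizer).toEquiv, card_K4]
  let g : NK4 →* Equiv.Perm UnitForm :=
    ((QuotientGroup.kerLift (MulAction.toPermHom SL(2, ZMod 4) UnitForm)).comp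
      (QuotientGroup.quotientMulEquivOfEq toPermHom_unitForm_ker.symm).toMonoidHom).comp
      e.symm.toMonoidHom
  have hinj : Function.Injective g :=
    ((QuotientGroup.kerLift_injective _).comp (MulEquiv.injective _)).comp (MulEquiv.injective _)
  have hbij := hinj.bijective_of_nat_card_le (by
    rw [hcard, Nat.card_eq_fintype_card, Fintype.card_perm, card_unitForm]
    decide)
  exact ⟨(MulEquiv.ofBijective _ hbij).trans (Fintype.equivFinOfCardEq card_unitForm).permCongrHom⟩

theorem NK4_quotient_equiv_perm (e' : SL(2, ZMod 2) ≃* NK4 ⧸ K4.subgroupOf NK4) :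
    Nonempty (NK4 ⧸ K4.subgroupOf NK4 ≃* Equiv.Perm (Fin 3)) :=
  SL2_two_equiv_perm.map fun e => e'.symm.trans e

end PsiConsequences

/-! ### Liouville's theorem for the lattice `2ℤ + 2ℤτ`. -/

theorem exists_real_coords (τ : ℍ) (z : ℂ) : ∃ s t : ℝ, z = s + t * (τ : ℂ) := by
  have hτ : (τ : ℂ).im ≠ 0 := τ.im_pos.ne'
  refine ⟨z.re - z.im / (τ : ℂ).im * (τ : ℂ).re, z.im / (τ : ℂ).im, ?_⟩
  apply Complex.ext
  · simp
  · simp only [add_im, ofReal_im, mul_im, ofReal_re, zero_add, zero_mul, add_zero]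
    rw [div_mul_cancel₀ _ hτ]

/-- An entire function with periods `2` and `2τ` is constant. -/
theorem const_of_differentiable_of_biperiodic (τ : ℍ) {g : ℂ → ℂ} (hg : Differentiable ℂ g)
    (h1 : Function.Periodic g 2) (h2 : Function.Periodic g (2 * (τ : ℂ))) :
    ∃ c, ∀ z, g z = c := by
  refine hg.exists_const_forall_eq_of_bounded ?_
  have hK : IsCompact ((fun p : ℝ × ℝ => (p.1 * 2 + p.2 * (2 * (τ : ℂ)) : ℂ)) ''
      (Set.Icc 0 1 ×ˢ Set.Icc 0 1)) :=
    (isCompact_Icc.prod isCompact_Icc).image (by fun_prop)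
  refine ((hK.image hg.continuous).isBounded).subset ?_
  rintro _ ⟨z, rfl⟩
  obtain ⟨s, t, rfl⟩ := exists_real_coords τ z
  refine ⟨_, ⟨(Int.fract (s / 2), Int.fract (t / 2)), ⟨⟨Int.fract_nonneg _, (Int.fract_lt_one _).le⟩,
    ⟨Int.fract_nonneg _, (Int.fract_lt_one _).le⟩⟩, rfl⟩, ?_⟩
  have e : (s + t * (τ : ℂ) : ℂ) = ((Int.fract (s / 2) : ℝ) : ℂ) * 2 +
      ((Int.fract (t / 2) : ℝ) : ℂ) * (2 * (τ : ℂ)) + ⌊s / 2⌋ * 2 + ⌊t / 2⌋ * (2 * (τ : ℂ)) := by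
    rw [Int.fract, Int.fract]
    push_cast
    ring
  rw [e, (h2.int_mul _), (h1.int_mul _)]

/-- A meromorphic function without poles, with periods `2` and `2τ`, is constant up to its values
at isolated points. -/
theorem const_of_meromorphic_of_biperiodic (τ : ℍ) {g : ℂ → ℂ} (hg : ∀ z, MeromorphicAt g z)
    (h0 : ∀ z, 0 ≤ meromorphicOrderAt g z)
    (h1 : Function.Periodic g 2) (h2 : Function.Periodic g (2 * (τ : ℂ))) :
    ∃ c, ∀ z, g =ᶠ[𝓝[≠] z] fun _ => c := by
  have hgU : MeromorphicOn g Set.univ := fun z _ => hg z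
  -- Passing to normal form fills in the removable singularities, so `G` is entire.
  set G := toMeromorphicNFOn g Set.univ with hG
  have hGg : ∀ z, g =ᶠ[𝓝[≠] z] G := fun z =>
    (MeromorphicOn.toMeromorphicNFOn_eq_self_on_nhdsNE hgU (Set.mem_univ z)).symm
  have hGan : ∀ z, AnalyticAt ℂ G z := fun z => by
    rw [← (meromorphicNFOn_toMeromorphicNFOn g Set.univ
      (Set.mem_univ z)).meromorphicOrderAt_nonneg_iff_analyticAt,
      ← meromorphicOrderAt_congr (hGg z)]
    exact h0 z
  -- `G` agrees with `g` only on punctured neighbourhoods, so its periodicity is recovered by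
  -- continuity.
  have hper : ∀ a : ℂ, Function.Periodic g a → Function.Periodic G a := by
    intro a ha z
    have hsh : Filter.Tendsto (fun w => w + a) (𝓝[≠] z) (𝓝[≠] (z + a)) := by
      refine tendsto_nhdsWithin_iff.2 ⟨?_, ?_⟩
      · exact ((continuous_add_const a).tendsto z).mono_left nhdsWithin_le_nhds
      · filter_upwards [self_mem_nhdsWithin] with w hw
        simpa using hw
    have e : (fun w => G (w + a)) =ᶠ[𝓝[≠] z] G := by
      filter_upwards [hsh.eventually (hGg (z + a)), hGg z] with w hw1 hw2
      rw [← hw1, ← hw2, ha]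
    have l1 : Filter.Tendsto (fun w => G (w + a)) (𝓝[≠] z) (𝓝 (G (z + a))) :=
      ((hGan (z + a)).continuousAt.tendsto.comp
        ((continuous_add_const a).tendsto z)).mono_left nhdsWithin_le_nhds
    have l2 : Filter.Tendsto G (𝓝[≠] z) (𝓝 (G z)) :=
      (hGan z).continuousAt.tendsto.mono_left nhdsWithin_le_nhds
    exact tendsto_nhds_unique (l1.congr' e) l2
  obtain ⟨c, hc⟩ := const_of_differentiable_of_biperiodic τ
    (fun z => (hGan z).differentiableAt) (hper _ h1) (hper _ h2)
  exact ⟨c, fun z => (hGg z).trans (Filter.Eventually.of_forall hc)⟩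

theorem apply_eq_of_eventuallyEq_nhdsNE {f g : ℂ → ℂ} {z : ℂ} (hf : ContinuousAt f z)
    (hg : ContinuousAt g z) (h : f =ᶠ[𝓝[≠] z] g) : f z = g z :=
  tendsto_nhds_unique ((hf.tendsto.mono_left nhdsWithin_le_nhds).congr' h)
    (hg.tendsto.mono_left nhdsWithin_le_nhds)

/-! ### Zeros, poles, special values and translations of `f`. -/

namespace IsSpecialDevelopingMap

variable {τ : ℍ} {f : ℂ → ℂ}

theorem meromorphicNFAt (hf : IsSpecialDevelopingMap τ f) (z : ℂ) : MeromorphicNFAt f z := by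
  obtain ⟨u, -, hu⟩ := hf.developing
  exact hu.meromorphic (Set.mem_univ z)

theorem meromorphicAt (hf : IsSpecialDevelopingMap τ f) (z : ℂ) : MeromorphicAt f z :=
  (hf.meromorphicNFAt z).meromorphicAt

theorem order_eq_zero_iff (hf : IsSpecialDevelopingMap τ f) (z : ℂ) :
    meromorphicOrderAt f z = 0 ↔ f z ≠ 0 :=
  (hf.meromorphicNFAt z).meromorphicOrderAt_eq_zero_iff

theorem analyticAt (hf : IsSpecialDevelopingMap τ f) {z : ℂ} (h : 0 ≤ meromorphicOrderAt f z) :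
    AnalyticAt ℂ f z :=
  (hf.meromorphicNFAt z).meromorphicOrderAt_nonneg_iff_analyticAt.1 h

theorem add_two_tau (hf : IsSpecialDevelopingMap τ f) : Function.Periodic f (2 * (τ : ℂ)) := by
  intro z
  rw [two_mul, ← add_assoc, hf.typeI.2, hf.typeI.2, inv_inv]

theorem add_two (hf : IsSpecialDevelopingMap τ f) : Function.Periodic f 2 := by
  intro z
  rw [← one_add_one_eq_two, ← add_assoc, hf.typeI.1, hf.typeI.1, neg_neg]

theorem order_add_one (hf : IsSpecialDevelopingMap τ f) :
    Function.Periodic (meromorphicOrderAt f) 1 := by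
  intro z
  rw [← meromorphicOrderAt_comp_add_const_eq_meromorphicOrderAt,
    show f ∘ (· + 1) = -f from funext hf.typeI.1, ← meromorphicOrderAt_neg]

theorem order_add_tau (hf : IsSpecialDevelopingMap τ f) (z : ℂ) :
    meromorphicOrderAt f (z + τ) = -meromorphicOrderAt f z := by
  rw [← meromorphicOrderAt_comp_add_const_eq_meromorphicOrderAt,
    show f ∘ (· + (τ : ℂ)) = f⁻¹ from funext hf.typeI.2, meromorphicOrderAt_inv]

theorem order_add_two_tau (hf : IsSpecialDevelopingMap τ f) :
    Function.Periodic (meromorphicOrderAt f) (2 * (τ : ℂ)) := by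
  intro z
  rw [two_mul, ← add_assoc, hf.order_add_tau, hf.order_add_tau, neg_neg]

theorem order_zero (hf : IsSpecialDevelopingMap τ f) (m n : ℤ) :
    meromorphicOrderAt f (1 / 2 + m + 2 * n * (τ : ℂ)) = 1 := by
  have h := hf.order_add_two_tau.int_mul n (1 / 2 + m)
  rw [show (1 / 2 + m + n * (2 * (τ : ℂ)) : ℂ) = 1 / 2 + m + 2 * n * (τ : ℂ) by ring] at h
  rw [h, ← mul_one (m : ℂ), hf.order_add_one.int_mul, hf.order_half]

theorem order_pole (hf : IsSpecialDevelopingMap τ f) (m n : ℤ) :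
    meromorphicOrderAt f (1 / 2 + m + (2 * n + 1) * (τ : ℂ)) = -1 := by
  rw [show (1 / 2 + m + (2 * n + 1) * (τ : ℂ) : ℂ) = 1 / 2 + m + 2 * n * (τ : ℂ) + τ by ring,
    hf.order_add_tau, hf.order_zero]

/-- Each point is a simple zero, a simple pole, or a point of order `0` of `f`. -/
theorem trichotomy (hf : IsSpecialDevelopingMap τ f) (z : ℂ) :
    meromorphicOrderAt f z = 0 ∨ (∃ m n : ℤ, z = 1 / 2 + m + 2 * n * (τ : ℂ)) ∨
      ∃ m n : ℤ, z = 1 / 2 + m + (2 * n + 1) * (τ : ℂ) := by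
  by_cases h : z - 1 / 2 ∈ latticeOf τ
  · obtain ⟨m, n, hmn⟩ := h
    rcases Int.even_or_odd' n with ⟨k, rfl | rfl⟩
    · refine Or.inr (Or.inl ⟨m, k, ?_⟩)
      push_cast at hmn
      linear_combination hmn
    · refine Or.inr (Or.inr ⟨m, k, ?_⟩)
      push_cast at hmn
      linear_combination hmn
  · exact Or.inl (hf.order_eq_zero z h)

theorem add_odd_tau (hf : IsSpecialDevelopingMap τ f) (z : ℂ) (n : ℤ) :
    f (z + (2 * n + 1) * (τ : ℂ)) = (f z)⁻¹ := by
  rw [show z + (2 * n + 1) * (τ : ℂ) = z + τ + n * (2 * (τ : ℂ)) by ring,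
    hf.add_two_tau.int_mul, hf.typeI.2]

theorem add_int (hf : IsSpecialDevelopingMap τ f) (z : ℂ) (m : ℤ) :
    f (z + m) = (-1) ^ m * f z := by
  rcases Int.even_or_odd' m with ⟨k, rfl | rfl⟩
  · rw [show z + ((2 * k : ℤ) : ℂ) = z + k * 2 by push_cast; ring, hf.add_two.int_mul,
      (even_two_mul k).neg_one_zpow, one_mul]
  · rw [show z + ((2 * k + 1 : ℤ) : ℂ) = z + 1 + k * 2 by push_cast; ring, hf.add_two.int_mul,
      (odd_two_mul_add_one k).neg_one_zpow, hf.typeI.1, neg_one_mul]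

/-- In the inversion law the poles of either function correspond to these points of the other, where
it must take the value `-1`. -/
theorem value_half_tau_add (hf : IsSpecialDevelopingMap τ f) (m n : ℤ) :
    f ((τ : ℂ) / 2 + m + n * (τ : ℂ)) = (-1) ^ m := by
  have hn : f ((τ : ℂ) / 2 + n * (τ : ℂ)) = 1 := by
    rcases Int.even_or_odd' n with ⟨k, rfl | rfl⟩
    · rw [show (τ : ℂ) / 2 + ((2 * k : ℤ) : ℂ) * (τ : ℂ) = (τ : ℂ) / 2 + k * (2 * (τ : ℂ)) by
        push_cast; ring, hf.add_two_tau.int_mul, hf.value_half_tau]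
    · push_cast
      rw [hf.add_odd_tau, hf.value_half_tau, inv_one]
  rw [add_right_comm, hf.add_int, hn, mul_one]

theorem analyticAt_half_tau_add (hf : IsSpecialDevelopingMap τ f) (m n : ℤ) :
    AnalyticAt ℂ f ((τ : ℂ) / 2 + m + n * (τ : ℂ)) := by
  apply hf.analyticAt
  rw [(hf.order_eq_zero_iff _).2 (by
    rw [hf.value_half_tau_add]
    exact zpow_ne_zero _ (by norm_num))]

/-- The poles have imaginary part an odd multiple of `Im τ`, which is never `0`. -/
theorem analyticAt_zero (hf : IsSpecialDevelopingMap τ f) : AnalyticAt ℂ f 0 := by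
  apply hf.analyticAt
  rcases hf.trichotomy 0 with h | ⟨m, n, h⟩ | ⟨m, n, h⟩
  · exact h.ge
  · rw [h, hf.order_zero]
    exact zero_le_one
  · exfalso
    have him := congrArg Complex.im h
    simp only [zero_im, add_im, mul_im, intCast_im, intCast_re, one_im, re_ofNat, im_ofNat,
      add_re, mul_re, one_re] at him
    norm_num at him
    rcases him with h1 | h1
    · have h2 : ((2 * n + 1 : ℤ) : ℝ) = 0 := by
        push_cast
        linarith
      have : (2 * n + 1 : ℤ) = 0 := Int.cast_eq_zero.1 h2
      omega
    · exact τ.im_pos.ne' h1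

theorem sphereValue_of_order_nonneg {f : ℂ → ℂ} {z : ℂ} (h : 0 ≤ meromorphicOrderAt f z) :
    sphereValue f z = ((f z : ℂ) : OnePoint ℂ) := by
  rw [sphereValue, if_neg (not_lt.2 h)]

theorem sphereValue_of_order_neg {f : ℂ → ℂ} {z : ℂ} (h : meromorphicOrderAt f z < 0) :
    sphereValue f z = OnePoint.infty := by
  rw [sphereValue, if_pos h]

theorem sphereValue_add_one (hf : IsSpecialDevelopingMap τ f) (z : ℂ) :
    sphereValue f (z + 1) = kA • sphereValue f z := by
  have ho := hf.order_add_one z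
  rcases lt_or_ge (meromorphicOrderAt f z) 0 with h | h
  · rw [sphereValue_of_order_neg h, sphereValue_of_order_neg (ho ▸ h), kA_smul_infty]
  · rw [sphereValue_of_order_nonneg h, sphereValue_of_order_nonneg (ho ▸ h), kA_smul_coe,
      hf.typeI.1]

theorem sphereValue_add_tau (hf : IsSpecialDevelopingMap τ f) (z : ℂ) :
    sphereValue f (z + τ) = kB • sphereValue f z := by
  have ho := hf.order_add_tau z
  rcases hf.trichotomy z with h | ⟨m, n, rfl⟩ | ⟨m, n, rfl⟩
  · rw [sphereValue_of_order_nonneg h.ge, sphereValue_of_order_nonneg (by rw [ho, h, neg_zero]),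
      kB_smul_coe ((hf.order_eq_zero_iff z).1 h), hf.typeI.2]
  · have h := hf.order_zero m n
    rw [h] at ho
    have h0 : f (1 / 2 + m + 2 * n * (τ : ℂ)) = 0 := by
      by_contra h'
      rw [← ne_eq, ← hf.order_eq_zero_iff, h] at h'
      exact one_ne_zero h'
    rw [sphereValue_of_order_nonneg (z := 1 / 2 + m + 2 * n * (τ : ℂ)) (h ▸ zero_le_one), h0,
      kB_smul_zero, sphereValue_of_order_neg (by rw [ho]; exact WithTop.coe_lt_coe.2 (by norm_num))]
  · have h := hf.order_pole m n
    rw [h, neg_neg] at ho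
    have h0 : f (1 / 2 + m + (2 * n + 1) * (τ : ℂ)) = 0 := by
      by_contra h'
      rw [← ne_eq, ← hf.order_eq_zero_iff, h] at h'
      exact absurd h' (by decide)
    rw [sphereValue_of_order_neg (z := 1 / 2 + m + (2 * n + 1) * (τ : ℂ))
      (by rw [h]; exact WithTop.coe_lt_coe.2 (by norm_num)), kB_smul_infty, sphereValue_of_order_nonneg (ho ▸ zero_le_one), hf.typeI.2, h0, inv_zero]

theorem smul_zpow_of_shift {X : Type*} [MulAction PSU2 X] {S : ℂ → X} {a : ℂ} {k : PSU2}
    (h : ∀ z, S (z + a) = k • S z) (z : ℂ) (n : ℤ) : S (z + n * a) = k ^ n • S z := by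
  induction n using Int.induction_on with
  | zero => simp
  | succ n ih =>
    rw [show z + ((n + 1 : ℤ) : ℂ) * a = z + ((n : ℤ) : ℂ) * a + a by push_cast; ring, h, ih,
      smul_smul, zpow_add_one, (Commute.refl k).zpow_right n |>.eq]
  | pred n ih =>
    rw [zpow_sub_one, (Commute.refl k).inv_left.zpow_right _ |>.eq.symm, mul_smul, ← ih,
      eq_inv_smul_iff, ← h]
    congr 1
    push_cast
    ring

/-- Translations by lattice vectors act on the values of `f` through Klein's four group. -/
theorem sphereValue_add (hf : IsSpecialDevelopingMap τ f) (z : ℂ) (m n : ℤ) :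
    sphereValue f (z + m + n * (τ : ℂ)) = (kA ^ m * kB ^ n) • sphereValue f z := by
  have h1 := smul_zpow_of_shift hf.sphereValue_add_one z m
  rw [mul_one] at h1
  rw [smul_zpow_of_shift hf.sphereValue_add_tau, h1, smul_smul,
    K4_comm (K4.zpow_mem kB_mem n) (K4.zpow_mem kA_mem m)]

theorem sphereValue_half (hf : IsSpecialDevelopingMap τ f) :
    sphereValue f (1 / 2) = ((0 : ℂ) : OnePoint ℂ) := by
  rw [sphereValue_of_order_nonneg (hf.order_half ▸ zero_le_one)]
  congr 1
  by_contra h'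
  rw [← ne_eq, ← hf.order_eq_zero_iff, hf.order_half] at h'
  exact one_ne_zero h'

theorem sphereValue_half_tau (hf : IsSpecialDevelopingMap τ f) :
    sphereValue f ((τ : ℂ) / 2) = ((1 : ℂ) : OnePoint ℂ) := by
  rw [sphereValue_of_order_nonneg ((hf.order_eq_zero_iff _).2 (by
    rw [hf.value_half_tau]; exact one_ne_zero)).ge, hf.value_half_tau]

theorem sphereValue_half_add_tau (hf : IsSpecialDevelopingMap τ f) :
    sphereValue f (1 / 2 + τ) = OnePoint.infty := by
  rw [hf.sphereValue_add_tau, hf.sphereValue_half, kB_smul_zero]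

/-- An element of `PSU(2)` is determined by its effect on the values of `f`. -/
theorem eq_of_smul_sphereValue (hf : IsSpecialDevelopingMap τ f) {x y : PSU2}
    (h : ∀ z, x • sphereValue f z = y • sphereValue f z) : x = y := by
  apply PSU2.eq_of_agree
  · rw [← hf.sphereValue_half, h]
  · rw [← hf.sphereValue_half_tau, h]
  · rw [← hf.sphereValue_half_add_tau, h]

end IsSpecialDevelopingMap

/-! ### The inversion law. -/

/-- The zero of `b` cancels the simple pole of `a`. -/
theorem order_mul_add_nonneg {a b e : ℂ → ℂ} {z : ℂ} (ha : meromorphicOrderAt a z = -1)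
    (hb : AnalyticAt ℂ b z) (hb0 : b z = 0) (he : AnalyticAt ℂ e z) :
    0 ≤ meromorphicOrderAt (fun w => a w * b w + e w) z := by
  have ham : MeromorphicAt a z := meromorphicAt_of_meromorphicOrderAt_ne_zero (by rw [ha]; decide)
  have hb1 : (1 : WithTop ℤ) ≤ meromorphicOrderAt b z := by
    rw [hb.meromorphicOrderAt_eq]
    have h0 : analyticOrderAt b z ≠ 0 := hb.analyticOrderAt_ne_zero.2 hb0
    cases h : analyticOrderAt b z with
    | top => simp
    | coe n =>
      have hn : n ≠ 0 := by rintro rfl; exact h0 h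
      simpa using Nat.one_le_iff_ne_zero.2 hn
  refine le_trans (le_min ?_ he.meromorphicOrderAt_nonneg)
    (meromorphicOrderAt_add (ham.mul hb.meromorphicAt) he.meromorphicAt)
  change 0 ≤ meromorphicOrderAt (a * b) z
  rw [meromorphicOrderAt_mul ham hb.meromorphicAt, ha]
  calc (0 : WithTop ℤ) = -1 + 1 := by decide
    _ ≤ _ := by gcongr

theorem cocycleJ_ne_zero (γ : SL(2, ℤ)) (τ : ℍ) : cocycleJ γ τ ≠ 0 := by
  have := UpperHalfPlane.denom_ne_zero (Matrix.SpecialLinearGroup.toGL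
    (Matrix.SpecialLinearGroup.map (Int.castRingHom ℝ) γ)) τ
  simpa [UpperHalfPlane.denom, cocycleJ] using this

theorem coe_smul_eq (γ : SL(2, ℤ)) (τ : ℍ) : ((γ • τ : ℍ) : ℂ) =
    (((γ 0 0 : ℤ) : ℂ) * (τ : ℂ) + ((γ 0 1 : ℤ) : ℂ)) / cocycleJ γ τ := by
  rw [UpperHalfPlane.coe_specialLinearGroup_apply]
  simp [cocycleJ]

theorem cocycleJ_mul (γ δ : SL(2, ℤ)) (τ : ℍ) :
    cocycleJ (γ * δ) τ = cocycleJ γ (δ • τ) * cocycleJ δ τ := by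
  rw [cocycleJ, cocycleJ, coe_smul_eq, add_mul, mul_assoc, div_mul_cancel₀ _ (cocycleJ_ne_zero δ τ),
    cocycleJ]
  simp only [Matrix.SpecialLinearGroup.coe_mul, Matrix.mul_apply, Fin.sum_univ_two]
  push_cast
  ring

/-- The inversion law `(f + 1) (g + 1) = 2`, where `g` belongs to `-1 / τ`. -/
theorem IsSpecialDevelopingMap.sphereValue_inversion {τ τ' : ℍ} (hτ : (τ' : ℂ) * (τ : ℂ) = -1)
    {f g : ℂ → ℂ} (hf : IsSpecialDevelopingMap τ f) (hg : IsSpecialDevelopingMap τ' g) (z : ℂ) :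
    sphereValue g ((τ' : ℂ) * z) = PSU2.mk matS • sphereValue f z := by
  have hτ'0 : (τ' : ℂ) ≠ 0 := τ'.ne_zero
  have hlin : ∀ z, AnalyticAt ℂ (fun z => (τ' : ℂ) * z) z := fun z => by fun_prop
  have hgan : ∀ z, AnalyticAt ℂ g ((τ' : ℂ) * z) → AnalyticAt ℂ (fun z => g ((τ' : ℂ) * z)) z :=
    fun z h => h.comp (hlin z)
  have hgord : ∀ z, meromorphicOrderAt (fun z => g ((τ' : ℂ) * z)) z =
      meromorphicOrderAt g ((τ' : ℂ) * z) := fun z =>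
    meromorphicOrderAt_comp_of_deriv_ne_zero (f := g) (g := fun z => (τ' : ℂ) * z) (hlin z)
      (by rw [deriv_const_mul_id']; exact hτ'0)
  have hgm : ∀ z, MeromorphicAt (fun z => g ((τ' : ℂ) * z)) z := fun z =>
    (hg.meromorphicAt _).comp_analyticAt (hlin z)
  have odd_pow : ∀ n : ℤ, (-1 : ℂ) ^ (2 * n + 1) = -1 := fun n =>
    (odd_two_mul_add_one n).neg_one_zpow
  -- at a pole of `f`
  have hfp : ∀ m n : ℤ, g ((τ' : ℂ) * (1 / 2 + m + (2 * n + 1) * (τ : ℂ))) = -1 ∧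
      AnalyticAt ℂ g ((τ' : ℂ) * (1 / 2 + m + (2 * n + 1) * (τ : ℂ))) := by
    intro m n
    have e : (τ' : ℂ) * (1 / 2 + m + (2 * n + 1) * (τ : ℂ)) =
        (τ' : ℂ) / 2 + ((2 * (-n - 1) + 1 : ℤ) : ℂ) + m * (τ' : ℂ) := by
      push_cast
      linear_combination (2 * n + 1) * hτ
    rw [e]
    exact ⟨by rw [hg.value_half_tau_add, odd_pow], hg.analyticAt_half_tau_add _ _⟩
  -- at a pole of `g`
  have hgp : ∀ (z : ℂ) (m n : ℤ), (τ' : ℂ) * z = 1 / 2 + m + (2 * n + 1) * (τ' : ℂ) →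
      f z = -1 ∧ AnalyticAt ℂ f z := by
    intro z m n h
    have e : z = (τ : ℂ) / 2 + ((2 * n + 1 : ℤ) : ℂ) + ((-m - 1 : ℤ) : ℂ) * (τ : ℂ) := by
      apply mul_left_cancel₀ hτ'0
      push_cast
      linear_combination h - (1 / 2 - m - 1) * hτ
    rw [e]
    exact ⟨by rw [hf.value_half_tau_add, odd_pow], hf.analyticAt_half_tau_add _ _⟩
  -- A pole of one factor is simple and meets a zero of the other, so `φ` is elliptic without poles
  -- and hence constant.
  set φ : ℂ → ℂ := fun z => (f z + 1) * (g ((τ' : ℂ) * z) + 1) - 2 with hφ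
  have hφm : ∀ z, MeromorphicAt φ z := fun z =>
    (((hf.meromorphicAt z).add (MeromorphicAt.const 1 z)).mul
      ((hgm z).add (MeromorphicAt.const 1 z))).sub (MeromorphicAt.const 2 z)
  have hord : ∀ z, (0 ≤ meromorphicOrderAt f z ∧ 0 ≤ meromorphicOrderAt g ((τ' : ℂ) * z)) ∨
      (∃ m n : ℤ, z = 1 / 2 + m + (2 * n + 1) * (τ : ℂ)) ∨
      (∃ m n : ℤ, (τ' : ℂ) * z = 1 / 2 + m + (2 * n + 1) * (τ' : ℂ)) := by
    intro z
    rcases hf.trichotomy z with h1 | ⟨m, n, rfl⟩ | h1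
    · rcases hg.trichotomy ((τ' : ℂ) * z) with h2 | ⟨m, n, h2⟩ | h2
      · exact Or.inl ⟨h1.ge, h2.ge⟩
      · exact Or.inl ⟨h1.ge, by rw [h2, hg.order_zero]; exact zero_le_one⟩
      · exact Or.inr (Or.inr h2)
    · have hf0 : 0 ≤ meromorphicOrderAt f (1 / 2 + m + 2 * n * (τ : ℂ)) := by
        rw [hf.order_zero]; exact zero_le_one
      rcases hg.trichotomy ((τ' : ℂ) * (1 / 2 + m + 2 * n * (τ : ℂ))) with h2 | ⟨k, l, h2⟩ | h2
      · exact Or.inl ⟨hf0, h2.ge⟩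
      · exact Or.inl ⟨hf0, by rw [h2, hg.order_zero]; exact zero_le_one⟩
      · exact Or.inr (Or.inr h2)
    · exact Or.inr (Or.inl h1)
  have hφ0 : ∀ z, 0 ≤ meromorphicOrderAt φ z := by
    intro z
    rcases hord z with ⟨h1, h2⟩ | ⟨m, n, rfl⟩ | ⟨m, n, h⟩
    · have h1 := hf.analyticAt h1
      have h2 := hgan z (hg.analyticAt h2)
      exact (((h1.add analyticAt_const).mul (h2.add analyticAt_const)).sub
        analyticAt_const).meromorphicOrderAt_nonneg
    · obtain ⟨h1, h2⟩ := hfp m n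
      have h2 := hgan _ h2
      -- With `g` taken at `τ'z`, one has `φ = f (g + 1) + (g - 1)`; the next case uses the same
      -- splitting with `f` and `g` exchanged.
      have := order_mul_add_nonneg (hf.order_pole m n) (h2.add analyticAt_const)
        (by simp only [Pi.add_apply]; rw [h1]; exact neg_add_cancel 1)
        (h2.sub (analyticAt_const (v := 1)))
      refine this.trans_eq (meromorphicOrderAt_congr (Filter.Eventually.of_forall fun w => ?_))
      simp only [hφ, Pi.add_apply, Pi.sub_apply]
      ring
    · obtain ⟨h1, h2⟩ := hgp z m n h
      have := order_mul_add_nonneg ((hgord z).trans (h ▸ hg.order_pole m n))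
        (h2.add analyticAt_const)
        (by simp only [Pi.add_apply]; rw [h1]; exact neg_add_cancel 1)
        (h2.sub (analyticAt_const (v := 1)))
      refine this.trans_eq (meromorphicOrderAt_congr (Filter.Eventually.of_forall fun w => ?_))
      simp only [hφ, Pi.add_apply, Pi.sub_apply]
      ring
  -- The shifts of `z` by `2` and `2τ` shift `τ'z` by `2τ'` and `-2`, both periods of `g`.
  obtain ⟨c, hc⟩ := const_of_meromorphic_of_biperiodic τ hφm hφ0
    (fun z => by
      simp only [hφ]
      rw [hf.add_two, mul_add (τ' : ℂ) z 2, mul_comm (τ' : ℂ) 2, hg.add_two_tau])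
    (fun z => by
      simp only [hφ]
      rw [hf.add_two_tau, mul_add (τ' : ℂ) z, show (τ' : ℂ) * (2 * (τ : ℂ)) = -2 by linear_combination 2 * hτ,
        ← sub_eq_add_neg, hg.add_two.sub_eq])
  have han : ∀ z, 0 ≤ meromorphicOrderAt f z → 0 ≤ meromorphicOrderAt g ((τ' : ℂ) * z) →
      (f z + 1) * (g ((τ' : ℂ) * z) + 1) - 2 = c := by
    intro z h1 h2
    refine apply_eq_of_eventuallyEq_nhdsNE (f := φ) (g := fun _ => c) ?_ continuousAt_const (hc z)
    exact ((((hf.analyticAt h1).add analyticAt_const).mul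
      ((hgan z (hg.analyticAt h2)).add analyticAt_const)).sub analyticAt_const).continuousAt
  -- At `z = 1/2` one has `f = 0` and `g(τ'/2) = 1`.
  have hc0 : c = 0 := by
    have h0 : f (1 / 2) = 0 := by
      by_contra h
      rw [← ne_eq, ← hf.order_eq_zero_iff, hf.order_half] at h
      exact one_ne_zero h
    have h1 : g ((τ' : ℂ) * (1 / 2)) = 1 := by rw [mul_one_div, hg.value_half_tau]
    rw [← han (1 / 2) (hf.order_half ▸ zero_le_one) ((hg.order_eq_zero_iff _).2
      (by rw [h1]; exact one_ne_zero)).ge, h0, h1]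
    norm_num
  rcases hord z with ⟨h1, h2⟩ | ⟨m, n, rfl⟩ | ⟨m, n, h⟩
  · have h := han z h1 h2
    rw [hc0] at h
    have hne : 1 + f z ≠ 0 := by
      intro h'
      rw [add_comm, h', zero_mul] at h
      norm_num at h
    rw [sphereValue_of_order_nonneg h1, sphereValue_of_order_nonneg h2, matS_smul_coe hne]
    congr 1
    rw [eq_div_iff hne]
    linear_combination h
  · obtain ⟨h1, h2⟩ := hfp m n
    rw [sphereValue_of_order_nonneg h2.meromorphicOrderAt_nonneg, h1,
      sphereValue_of_order_neg (by rw [hf.order_pole]; decide), matS_smul_infty]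
  · obtain ⟨h1, h2⟩ := hgp z m n h
    rw [sphereValue_of_order_nonneg h2.meromorphicOrderAt_nonneg, h1, h,
      sphereValue_of_order_neg (by rw [hg.order_pole]; decide), matS_smul_neg_one]

/-! ### The infinite product `∏ (1 + y Pⁿ)` -/

/-- The product `∏ₙ (1 + y Pⁿ)`. -/
noncomputable def qProd (y P : ℂ) : ℂ := ∏' n : ℕ, (1 + y * P ^ n)

theorem summable_norm_mul_pow (y : ℂ) {P : ℂ} (hP : ‖P‖ < 1) :
    Summable fun n : ℕ => ‖y * P ^ n‖ := by
  simp_rw [norm_mul, norm_pow]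
  exact (summable_geometric_of_lt_one (norm_nonneg _) hP).mul_left _

theorem qProd_eq (y : ℂ) {P : ℂ} (hP : ‖P‖ < 1) :
    qProd y P = (1 + y) * qProd (P * y) P := by
  rw [qProd, tprod_eq_zero_mul']
  · rw [pow_zero, mul_one, qProd]
    congr 1
    refine tprod_congr fun n => ?_
    rw [pow_succ]
    ring
  · refine (multipliable_one_add_of_summable (f := fun n : ℕ => P * y * P ^ n)
      (summable_norm_mul_pow (P * y) hP)).congr fun n => ?_
    rw [pow_succ]
    ring

theorem qProd_ne_zero {y P : ℂ} (hP : ‖P‖ < 1) (h : ∀ n : ℕ, 1 + y * P ^ n ≠ 0) :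
    qProd y P ≠ 0 :=
  tprod_one_add_ne_zero_of_summable h (summable_norm_mul_pow y hP)

/-- The majorant `R rⁿ` serves both variables at once. Joint uniformity is what later makes Taylor
coefficients in `z` holomorphic in `q`. -/
theorem tendstoLocallyUniformlyOn_qProd {R r : ℝ} (hR : 0 ≤ R) (hr0 : 0 ≤ r) (hr : r < 1) :
    TendstoLocallyUniformlyOn (fun (N : ℕ) (p : ℂ × ℂ) => ∏ n ∈ Finset.range N, (1 + p.1 * p.2 ^ n))
      (fun p => qProd p.1 p.2) Filter.atTop (Metric.ball 0 R ×ˢ Metric.ball 0 r) := by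
  refine HasProdLocallyUniformlyOn.tendstoLocallyUniformlyOn_finsetRange
    (Summable.hasProdLocallyUniformlyOn_nat_one_add (f := fun (n : ℕ) (p : ℂ × ℂ) => p.1 * p.2 ^ n)
      (Metric.isOpen_ball.prod Metric.isOpen_ball)
      ((summable_geometric_of_lt_one hr0 hr).mul_left R) ?_ fun n => by fun_prop)
  refine Filter.Eventually.of_forall fun n p hp => ?_
  rw [norm_mul, norm_pow]
  have h1 := (mem_ball_zero_iff.1 hp.1).le
  have h2 := (mem_ball_zero_iff.1 hp.2).le
  gcongr

theorem differentiable_qProd {P : ℂ} (hP : ‖P‖ < 1) : Differentiable ℂ fun y => qProd y P := by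
  intro y
  have h := (tendstoLocallyUniformlyOn_qProd (R := ‖y‖ + 1) (r := (‖P‖ + 1) / 2) (by positivity)
    (by positivity) (by linarith)).comp (fun y : ℂ => (y, P)) (t := Metric.ball 0 (‖y‖ + 1))
    (fun w hw => ⟨hw, by rw [mem_ball_zero_iff]; change ‖P‖ < _; linarith⟩) (by fun_prop)
  refine (h.differentiableOn (Filter.Eventually.of_forall fun N => ?_)
    Metric.isOpen_ball).differentiableAt (Metric.isOpen_ball.mem_nhds ?_)
  · refine Differentiable.differentiableOn ?_
    change Differentiable ℂ fun y : ℂ => ∏ n ∈ Finset.range N, (1 + y * P ^ n)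
    fun_prop
  · rw [mem_ball_zero_iff]
    linarith

/-! ### Theta functions -/

/-- The factor `2 cos(πz) ∏ (1 + 2 cos(2πz) q⁸ⁿ + q¹⁶ⁿ)`, `n ≥ 1`. -/
noncomputable def thetaNum (q z : ℂ) : ℂ :=
  2 * Complex.cos (Real.pi * z) * (qProd (q ^ 8 * exp (2 * Real.pi * I * z)) (q ^ 8) *
    qProd (q ^ 8 * exp (-(2 * Real.pi * I * z))) (q ^ 8))

/-- The factor `∏ (1 + 2 cos(2πz) q⁸ⁿ⁻⁴ + q¹⁶ⁿ⁻⁸)`, `n ≥ 1`. -/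
noncomputable def thetaDen (q z : ℂ) : ℂ :=
  qProd (q ^ 4 * exp (2 * Real.pi * I * z)) (q ^ 8) *
    qProd (q ^ 4 * exp (-(2 * Real.pi * I * z))) (q ^ 8)

/-- The local parameter `e^{2πiτ/4}`. -/
noncomputable def nome (τ : ℍ) : ℂ := exp (2 * Real.pi * I * (τ : ℂ) / 4)

theorem nome_ne_zero (τ : ℍ) : nome τ ≠ 0 := exp_ne_zero _

theorem norm_nome_lt_one (τ : ℍ) : ‖nome τ‖ < 1 := by
  rw [nome, Complex.norm_exp, Real.exp_lt_one_iff]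
  have : (2 * Real.pi * I * (τ : ℂ) / 4).re = -(Real.pi / 2 * (τ : ℂ).im) := by
    simp [Complex.mul_re, Complex.mul_im]
    ring
  rw [this]
  have := τ.im_pos
  have := Real.pi_pos
  simp only [Left.neg_neg_iff]
  positivity

theorem norm_pow_lt_one {q : ℂ} (hq : ‖q‖ < 1) : ‖q ^ 8‖ < 1 := by
  rw [norm_pow]
  exact pow_lt_one₀ (norm_nonneg _) hq (by norm_num)

theorem nome_pow (τ : ℍ) (n : ℕ) : nome τ ^ n = exp (2 * Real.pi * I * (n * (τ : ℂ) / 4)) := by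
  rw [nome, ← Complex.exp_nat_mul]
  congr 1
  ring

theorem two_cos_pi (z : ℂ) : 2 * Complex.cos (Real.pi * z) =
    exp (-(Real.pi * I * z)) * (1 + exp (2 * Real.pi * I * z)) := by
  rw [Complex.cos, mul_add, mul_one, ← Complex.exp_add, mul_div_cancel₀ _ two_ne_zero, add_comm]
  congr 2 <;> ring

theorem thetaDen_add_one (q z : ℂ) : thetaDen q (z + 1) = thetaDen q z := by
  have h1 : exp (2 * Real.pi * I * (z + 1)) = exp (2 * Real.pi * I * z) := by
    rw [mul_add, mul_one, Complex.exp_add, Complex.exp_two_pi_mul_I, mul_one]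
  rw [thetaDen, thetaDen, Complex.exp_neg, h1, ← Complex.exp_neg]

theorem thetaNum_add_one (q z : ℂ) : thetaNum q (z + 1) = -thetaNum q z := by
  have h1 : exp (2 * Real.pi * I * (z + 1)) = exp (2 * Real.pi * I * z) := by
    rw [mul_add, mul_one, Complex.exp_add, Complex.exp_two_pi_mul_I, mul_one]
  have h2 : Complex.cos (Real.pi * (z + 1)) = -Complex.cos (Real.pi * z) := by
    rw [mul_add, mul_one, Complex.cos_add_pi]
  rw [thetaNum, thetaNum, Complex.exp_neg, h1, ← Complex.exp_neg, h2]
  ring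

theorem thetaNum_neg (q z : ℂ) : thetaNum q (-z) = thetaNum q z := by
  rw [thetaNum, thetaNum, mul_neg, Complex.cos_neg, mul_neg, neg_neg, mul_comm (qProd _ _)]

/-- As `e^{2πiτ} = q⁴`, the shift turns one product of `D` into one of `N`, and the other into one
of `N` with an additional first factor, which supplies the cosine. -/
theorem thetaDen_add_tau (τ : ℍ) (z : ℂ) : thetaDen (nome τ) (z + τ) =
    exp (-(Real.pi * I * z)) * thetaNum (nome τ) z := by
  have hq := norm_pow_lt_one (norm_nome_lt_one τ)
  have e1 : nome τ ^ 4 * exp (2 * Real.pi * I * (z + τ)) =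
      nome τ ^ 8 * exp (2 * Real.pi * I * z) := by
    rw [nome_pow, nome_pow, ← Complex.exp_add, ← Complex.exp_add]
    congr 1
    push_cast
    ring
  have e2 : nome τ ^ 4 * exp (-(2 * Real.pi * I * (z + τ))) = exp (-(2 * Real.pi * I * z)) := by
    rw [nome_pow, ← Complex.exp_add]
    congr 1
    push_cast
    ring
  have e3 : exp (-(Real.pi * I * z)) * (2 * Complex.cos (Real.pi * z)) =
      1 + exp (-(2 * Real.pi * I * z)) := by
    rw [two_cos_pi, ← mul_assoc, ← Complex.exp_add, mul_add, mul_one, ← Complex.exp_add, add_comm,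
      show -(Real.pi * I * z) + -(Real.pi * I * z) + 2 * Real.pi * I * z = 0 by ring,
      Complex.exp_zero]
    congr 2
    ring
  rw [thetaDen, e1, e2, qProd_eq (exp (-(2 * Real.pi * I * z))) hq, thetaNum, ← e3]
  ring

/-- The shifted product lacks its first factor `1 + q⁴e^{2πiz}`, which is exactly what the cosine
contributes. -/
theorem thetaNum_add_tau (τ : ℍ) (z : ℂ) : thetaNum (nome τ) (z + τ) =
    exp (-(Real.pi * I * (z + τ))) * thetaDen (nome τ) z := by
  have hq := norm_pow_lt_one (norm_nome_lt_one τ)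
  have e1 : nome τ ^ 8 * exp (2 * Real.pi * I * (z + τ)) =
      nome τ ^ 8 * (nome τ ^ 4 * exp (2 * Real.pi * I * z)) := by
    rw [nome_pow τ 4, ← Complex.exp_add]
    congr 2
    push_cast
    ring
  have e2 : nome τ ^ 8 * exp (-(2 * Real.pi * I * (z + τ))) =
      nome τ ^ 4 * exp (-(2 * Real.pi * I * z)) := by
    rw [nome_pow, nome_pow, ← Complex.exp_add, ← Complex.exp_add]
    congr 1
    push_cast
    ring
  have e3 : exp (2 * Real.pi * I * (z + τ)) = nome τ ^ 4 * exp (2 * Real.pi * I * z) := by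
    rw [nome_pow, ← Complex.exp_add]
    congr 1
    push_cast
    ring
  rw [thetaNum, e1, e2, two_cos_pi, e3, thetaDen,
    qProd_eq (nome τ ^ 4 * exp (2 * Real.pi * I * z)) hq]
  ring

theorem differentiable_thetaNum {q : ℂ} (hq : ‖q‖ < 1) : Differentiable ℂ (thetaNum q) := by
  have h := differentiable_qProd (norm_pow_lt_one hq)
  have h1 := h.comp (f := fun z : ℂ => q ^ 8 * exp (2 * Real.pi * I * z)) (by fun_prop)
  have h2 := h.comp (f := fun z : ℂ => q ^ 8 * exp (-(2 * Real.pi * I * z))) (by fun_prop)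
  have h3 : Differentiable ℂ fun z : ℂ => 2 * Complex.cos (Real.pi * z) := by fun_prop
  exact h3.mul (h1.mul h2)

theorem differentiable_thetaDen {q : ℂ} (hq : ‖q‖ < 1) : Differentiable ℂ (thetaDen q) := by
  have h := differentiable_qProd (norm_pow_lt_one hq)
  have h1 := h.comp (f := fun z : ℂ => q ^ 4 * exp (2 * Real.pi * I * z)) (by fun_prop)
  have h2 := h.comp (f := fun z : ℂ => q ^ 4 * exp (-(2 * Real.pi * I * z))) (by fun_prop)
  exact h1.mul h2

theorem exp_eq_neg_one {w : ℂ} (h : exp (2 * Real.pi * I * w) = -1) : ∃ k : ℤ, w = 1 / 2 + k := by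
  have : exp (2 * Real.pi * I * w - Real.pi * I) = 1 := by
    rw [Complex.exp_sub, h, Complex.exp_pi_mul_I, div_self (by norm_num)]
  obtain ⟨k, hk⟩ := Complex.exp_eq_one_iff.1 this
  refine ⟨k, ?_⟩
  have h0 : (2 * Real.pi * I : ℂ) ≠ 0 := Complex.two_pi_I_ne_zero
  apply mul_left_cancel₀ h0
  linear_combination hk

theorem qProd_nome_eq_zero {τ : ℍ} {z : ℂ}
    (h : qProd (nome τ ^ 8 * exp (2 * Real.pi * I * z)) (nome τ ^ 8) = 0) :
    ∃ m n : ℤ, z = 1 / 2 + m + 2 * n * (τ : ℂ) := by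
  by_contra! hne
  refine qProd_ne_zero (norm_pow_lt_one (norm_nome_lt_one τ)) (fun n hn => ?_) h
  have : exp (2 * Real.pi * I * (z + 2 * (n + 1) * (τ : ℂ))) = -1 := by
    rw [← eq_neg_of_add_eq_zero_right hn, ← pow_mul, nome_pow, nome_pow, ← Complex.exp_add,
      ← Complex.exp_add]
    congr 1
    push_cast
    ring
  obtain ⟨k, hk⟩ := exp_eq_neg_one this
  apply hne k (-(n + 1))
  push_cast
  linear_combination hk

theorem thetaNum_eq_zero {τ : ℍ} {z : ℂ} (h : thetaNum (nome τ) z = 0) :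
    ∃ m n : ℤ, z = 1 / 2 + m + 2 * n * (τ : ℂ) := by
  rcases mul_eq_zero.1 h with h | h
  · rw [two_cos_pi] at h
    rcases mul_eq_zero.1 h with h | h
    · exact absurd h (exp_ne_zero _)
    · obtain ⟨k, hk⟩ := exp_eq_neg_one (eq_neg_of_add_eq_zero_right h)
      exact ⟨k, 0, by rw [hk]; push_cast; ring⟩
  · rcases mul_eq_zero.1 h with h | h
    · exact qProd_nome_eq_zero h
    · rw [← mul_neg] at h
      obtain ⟨m, n, hmn⟩ := qProd_nome_eq_zero h
      refine ⟨-m - 1, -n, ?_⟩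
      push_cast
      linear_combination -hmn

/-- The cosine has a simple zero there, while each product becomes `∏ (1 - q⁸ⁿ)`, `n ≥ 1`, which is
nonzero since `|q| < 1`. -/
theorem order_thetaNum_half (τ : ℍ) : meromorphicOrderAt (thetaNum (nome τ)) (1 / 2) = 1 := by
  have hq := norm_nome_lt_one τ
  have h := differentiable_qProd (norm_pow_lt_one hq)
  have h1 := h.comp (f := fun z : ℂ => nome τ ^ 8 * exp (2 * Real.pi * I * z)) (by fun_prop)
  have h2 := h.comp (f := fun z : ℂ => nome τ ^ 8 * exp (-(2 * Real.pi * I * z))) (by fun_prop)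
  have h3 : Differentiable ℂ fun z : ℂ => 2 * Complex.cos (Real.pi * z) := by fun_prop
  have hx : exp (2 * Real.pi * I * (1 / 2)) = -1 := by
    rw [mul_one_div, mul_assoc, mul_div_cancel_left₀ _ two_ne_zero, Complex.exp_pi_mul_I]
  have hne : qProd (-nome τ ^ 8) (nome τ ^ 8) ≠ 0 := by
    refine qProd_ne_zero (norm_pow_lt_one hq) fun n hn => ?_
    have h1 : nome τ ^ (8 * (n + 1)) = 1 := by
      rw [pow_mul, pow_succ]
      linear_combination -hn
    have h2 : ‖nome τ ^ (8 * (n + 1))‖ < 1 := by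
      rw [norm_pow]
      exact pow_lt_one₀ (norm_nonneg _) hq (by omega)
    rw [h1, norm_one] at h2
    exact lt_irrefl _ h2
  have e : thetaNum (nome τ) = (fun z : ℂ => 2 * Complex.cos (Real.pi * z)) *
    (((fun y => qProd y (nome τ ^ 8)) ∘ fun z : ℂ => nome τ ^ 8 * exp (2 * Real.pi * I * z)) *
    ((fun y => qProd y (nome τ ^ 8)) ∘ fun z : ℂ => nome τ ^ 8 * exp (-(2 * Real.pi * I * z)))) :=
    rfl
  rw [e, mul_comm, meromorphicOrderAt_mul_of_ne_zero ((h1.mul h2).analyticAt _),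
    (h3.analyticAt _).meromorphicOrderAt_eq,
    (h3.analyticAt _).analyticOrderAt_eq_one_of_zero_deriv_ne_zero]
  · rfl
  · simp [← div_eq_mul_inv]
  · have hd : HasDerivAt (fun z : ℂ => 2 * Complex.cos (Real.pi * z))
        (2 * (-Complex.sin (Real.pi * (1 / 2)) * (Real.pi * 1))) (1 / 2) :=
      (((hasDerivAt_id (1 / 2 : ℂ)).const_mul (Real.pi : ℂ)).ccos).const_mul 2
    rw [hd.deriv, mul_one_div, Complex.sin_pi_div_two]
    simp [Real.pi_ne_zero]
  · simp only [Pi.mul_apply, Function.comp_apply]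
    rw [Complex.exp_neg, hx]
    simpa using hne

theorem order_thetaNum_add_one (q : ℂ) :
    Function.Periodic (meromorphicOrderAt (thetaNum q)) 1 := by
  intro z
  rw [← meromorphicOrderAt_comp_add_const_eq_meromorphicOrderAt,
    show thetaNum q ∘ (· + 1) = -thetaNum q from funext (thetaNum_add_one q),
    ← meromorphicOrderAt_neg]

theorem order_thetaDen_add_tau (τ : ℍ) (z : ℂ) :
    meromorphicOrderAt (thetaDen (nome τ)) (z + τ) = meromorphicOrderAt (thetaNum (nome τ)) z := by
  rw [← meromorphicOrderAt_comp_add_const_eq_meromorphicOrderAt,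
    show thetaDen (nome τ) ∘ (· + (τ : ℂ)) = (fun z => exp (-(Real.pi * I * z))) *
      thetaNum (nome τ) from funext (thetaDen_add_tau τ)]
  exact meromorphicOrderAt_mul_of_ne_zero (by fun_prop) (exp_ne_zero _)

theorem order_thetaNum_add_tau (τ : ℍ) (z : ℂ) :
    meromorphicOrderAt (thetaNum (nome τ)) (z + τ) = meromorphicOrderAt (thetaDen (nome τ)) z := by
  rw [← meromorphicOrderAt_comp_add_const_eq_meromorphicOrderAt,
    show thetaNum (nome τ) ∘ (· + (τ : ℂ)) = (fun z => exp (-(Real.pi * I * (z + τ)))) *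
      thetaDen (nome τ) from funext (thetaNum_add_tau τ)]
  exact meromorphicOrderAt_mul_of_ne_zero (by fun_prop) (exp_ne_zero _)

theorem order_thetaNum_zero (τ : ℍ) (m n : ℤ) :
    meromorphicOrderAt (thetaNum (nome τ)) (1 / 2 + m + 2 * n * (τ : ℂ)) = 1 := by
  have hper : Function.Periodic (meromorphicOrderAt (thetaNum (nome τ))) (2 * (τ : ℂ)) := by
    intro z
    rw [two_mul, ← add_assoc, order_thetaNum_add_tau, order_thetaDen_add_tau]
  have h := hper.int_mul n (1 / 2 + m)
  rw [show (1 / 2 + m + n * (2 * (τ : ℂ)) : ℂ) = 1 / 2 + m + 2 * n * (τ : ℂ) by ring] at h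
  rw [h, ← mul_one (m : ℂ), (order_thetaNum_add_one _).int_mul, order_thetaNum_half]

theorem order_thetaNum_of_ne (τ : ℍ) {z : ℂ} (h : ∀ m n : ℤ, z ≠ 1 / 2 + m + 2 * n * (τ : ℂ)) :
    meromorphicOrderAt (thetaNum (nome τ)) z = 0 := by
  have han := (differentiable_thetaNum (norm_nome_lt_one τ)).analyticAt z
  refine han.meromorphicNFAt.meromorphicOrderAt_eq_zero_iff.2 fun h0 => ?_
  obtain ⟨m, n, hmn⟩ := thetaNum_eq_zero h0
  exact h m n hmn

theorem eventually_thetaDen_ne_zero (τ : ℍ) (z : ℂ) :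
    ∀ᶠ w in 𝓝[≠] z, thetaDen (nome τ) w ≠ 0 := by
  have hD := (differentiable_thetaDen (norm_nome_lt_one τ)).analyticAt z
  rw [← meromorphicOrderAt_ne_top_iff_eventually_ne_zero hD.meromorphicAt, ← sub_add_cancel z τ,
    order_thetaDen_add_tau]
  by_cases h : ∃ m n : ℤ, z - τ = 1 / 2 + m + 2 * n * (τ : ℂ)
  · obtain ⟨m, n, h⟩ := h
    rw [h, order_thetaNum_zero]
    decide
  · push Not at h
    rw [order_thetaNum_of_ne τ h]
    decide

/-! ### The product formula and the translation law. -/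

namespace IsSpecialDevelopingMap

variable {τ : ℍ} {f : ℂ → ℂ}

theorem zero_ne_pole (hf : IsSpecialDevelopingMap τ f) (m n k l : ℤ) :
    (1 / 2 + m + 2 * n * (τ : ℂ) : ℂ) ≠ 1 / 2 + k + (2 * l + 1) * (τ : ℂ) := fun h => by
  have h1 := hf.order_zero m n
  rw [h, hf.order_pole] at h1
  exact absurd h1 (by decide)

/-- The product formula `f = q N / D`. -/
theorem mul_thetaDen (hf : IsSpecialDevelopingMap τ f) (z : ℂ) :
    (fun w => f w * thetaDen (nome τ) w) =ᶠ[𝓝[≠] z] fun w => nome τ * thetaNum (nome τ) w := by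
  have hq := norm_nome_lt_one τ
  have hN : ∀ z, AnalyticAt ℂ (thetaNum (nome τ)) z := (differentiable_thetaNum hq).analyticAt
  have hD : ∀ z, AnalyticAt ℂ (thetaDen (nome τ)) z := (differentiable_thetaDen hq).analyticAt
  have hDo : ∀ z, meromorphicOrderAt (thetaDen (nome τ)) z =
      meromorphicOrderAt (thetaNum (nome τ)) (z - τ) := fun z => by
    rw [← order_thetaDen_add_tau, sub_add_cancel]
  have hNz : ∀ z, meromorphicOrderAt f z = 0 → ∀ m n : ℤ, z ≠ 1 / 2 + m + 2 * n * (τ : ℂ) := by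
    rintro z h m n rfl
    rw [hf.order_zero] at h
    exact one_ne_zero h
  have hDz : ∀ z, meromorphicOrderAt f z = 0 → ∀ m n : ℤ, z - τ ≠ 1 / 2 + m + 2 * n * (τ : ℂ) := by
    intro z h m n hz
    rw [show z = 1 / 2 + m + (2 * n + 1) * (τ : ℂ) by linear_combination hz, hf.order_pole] at h
    exact absurd h (by decide)
  -- `N` and `D` have the zeros and the poles of `f` as their simple zeros, so `f D / N` has order
  -- `0` everywhere and Liouville's theorem applies.
  set g : ℂ → ℂ := f * thetaDen (nome τ) * (thetaNum (nome τ))⁻¹ with hg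
  have hgm : ∀ z, MeromorphicAt g z := fun z =>
    ((hf.meromorphicAt z).mul (hD z).meromorphicAt).mul (hN z).meromorphicAt.inv
  have hg0 : ∀ z, meromorphicOrderAt g z = 0 := by
    intro z
    rw [hg, meromorphicOrderAt_mul ((hf.meromorphicAt z).mul (hD z).meromorphicAt)
      (hN z).meromorphicAt.inv, meromorphicOrderAt_mul (hf.meromorphicAt z) (hD z).meromorphicAt,
      meromorphicOrderAt_inv, hDo]
    rcases hf.trichotomy z with h | ⟨m, n, rfl⟩ | ⟨m, n, rfl⟩
    · rw [h, order_thetaNum_of_ne τ (hNz z h), order_thetaNum_of_ne τ (hDz z h)]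
      decide
    · rw [hf.order_zero, order_thetaNum_zero, order_thetaNum_of_ne τ fun k l h =>
        hf.zero_ne_pole m n k l (by linear_combination h)]
      decide
    · rw [hf.order_pole, show (1 / 2 + m + (2 * n + 1) * (τ : ℂ) - τ : ℂ) =
        1 / 2 + m + 2 * n * (τ : ℂ) by ring, order_thetaNum_zero,
        order_thetaNum_of_ne τ fun k l h => hf.zero_ne_pole k l m n h.symm]
      decide
  obtain ⟨c, hc⟩ := const_of_meromorphic_of_biperiodic τ hgm (fun z => (hg0 z).ge)
    (fun z => by
      simp only [hg, Pi.mul_apply, Pi.inv_apply]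
      rw [hf.add_two, ← one_add_one_eq_two, ← add_assoc, thetaDen_add_one, thetaDen_add_one,
        thetaNum_add_one, thetaNum_add_one, neg_neg])
    (fun z => by
      simp only [hg, Pi.mul_apply, Pi.inv_apply]
      rw [hf.add_two_tau, two_mul, ← add_assoc, thetaDen_add_tau, thetaNum_add_tau,
        thetaNum_add_tau, thetaDen_add_tau]
      -- The automorphy factors of `D` and `N` under the shift by `2τ` coincide.
      have e : exp (-(Real.pi * I * (z + τ))) * (exp (-(Real.pi * I * (z + τ)))) =
          exp (-(Real.pi * I * (z + τ + τ))) * exp (-(Real.pi * I * z)) := by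
        rw [← Complex.exp_add, ← Complex.exp_add]
        congr 1
        ring
      rw [← mul_assoc (exp _), ← mul_assoc (exp _), e, mul_inv, mul_assoc (f z), mul_assoc (f z)]
      congr 1
      rw [mul_mul_mul_comm, mul_inv_cancel₀ (mul_ne_zero (exp_ne_zero _) (exp_ne_zero _)), one_mul])
  have hτ0 : meromorphicOrderAt f ((τ : ℂ) / 2) = 0 := (hf.order_eq_zero_iff _).2 (by
    rw [hf.value_half_tau]; exact one_ne_zero)
  have hNτ : thetaNum (nome τ) ((τ : ℂ) / 2) ≠ 0 := fun h => by
    obtain ⟨m, n, hmn⟩ := thetaNum_eq_zero h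
    exact hNz _ hτ0 m n hmn
  -- Shifting `-τ/2` by `τ` and using that `N` is even gives `D(τ/2) = q N(τ/2)`; with `f(τ/2) = 1`
  -- this fixes the constant as `q`.
  have hDτ : thetaDen (nome τ) ((τ : ℂ) / 2) = nome τ * thetaNum (nome τ) ((τ : ℂ) / 2) := by
    rw [show (τ : ℂ) / 2 = -((τ : ℂ) / 2) + τ by ring, thetaDen_add_tau, thetaNum_neg,
      show -((τ : ℂ) / 2) + τ = (τ : ℂ) / 2 by ring, nome]
    congr 2
    ring
  have hcq : c = nome τ := by
    have h := apply_eq_of_eventuallyEq_nhdsNE (f := g) (g := fun _ => c)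
      (((hf.analyticAt hτ0.ge).mul (hD _)).mul ((hN _).inv hNτ)).continuousAt
      continuousAt_const (hc ((τ : ℂ) / 2))
    rw [← h]
    simp only [hg, Pi.mul_apply, Pi.inv_apply]
    rw [hf.value_half_tau, hDτ, one_mul, mul_inv_cancel_right₀ hNτ]
  have hNne : ∀ᶠ w in 𝓝[≠] z, thetaNum (nome τ) w ≠ 0 := by
    rw [← meromorphicOrderAt_ne_top_iff_eventually_ne_zero (hN z).meromorphicAt]
    by_cases h : ∃ m n : ℤ, z = 1 / 2 + m + 2 * n * (τ : ℂ)
    · obtain ⟨m, n, rfl⟩ := h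
      rw [order_thetaNum_zero]
      decide
    · push Not at h
      rw [order_thetaNum_of_ne τ h]
      decide
  filter_upwards [hc z, hNne] with w hw hw0
  rw [hcq] at hw
  nth_rewrite 2 [← hw]
  simp only [hg, Pi.mul_apply, Pi.inv_apply]
  rw [inv_mul_cancel_right₀ hw0]

/-- The translation law `f(z; τ + 1) = i f(z; τ)`. -/
theorem sphereValue_translation {τ' : ℍ} (hτ : (τ' : ℂ) = τ + 1) {g : ℂ → ℂ}
    (hf : IsSpecialDevelopingMap τ f) (hg : IsSpecialDevelopingMap τ' g) (z : ℂ) :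
    sphereValue g z = PSU2.mk matT • sphereValue f z := by
  -- Only the prefactor `q` of the product formula sees this change, because `i⁴ = 1`.
  have hn : nome τ' = I * nome τ := by
    rw [nome, nome, hτ, show 2 * Real.pi * I * ((τ : ℂ) + 1) / 4 =
      Real.pi / 2 * I + 2 * Real.pi * I * τ / 4 by ring, Complex.exp_add,
      Complex.exp_pi_div_two_mul_I]
  have h4 : nome τ' ^ 4 = nome τ ^ 4 := by rw [hn, mul_pow, I_pow_four, one_mul]
  have h8 : nome τ' ^ 8 = nome τ ^ 8 := by
    rw [show 8 = 4 * 2 from rfl, pow_mul, h4, ← pow_mul]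
  have hD : thetaDen (nome τ') = thetaDen (nome τ) := by
    funext w
    rw [thetaDen, thetaDen, h4, h8]
  have hN : thetaNum (nome τ') = thetaNum (nome τ) := by
    funext w
    rw [thetaNum, thetaNum, h8]
  have he : g =ᶠ[𝓝[≠] z] (fun _ => I) * f := by
    filter_upwards [hf.mul_thetaDen z, hg.mul_thetaDen z, eventually_thetaDen_ne_zero τ z]
      with w h1 h2 h3
    rw [hD, hN, hn] at h2
    apply mul_right_cancel₀ h3
    rw [h2, Pi.mul_apply, mul_assoc I, mul_assoc I, h1]
  have ho : meromorphicOrderAt g z = meromorphicOrderAt f z := by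
    rw [meromorphicOrderAt_congr he]
    exact meromorphicOrderAt_mul_of_ne_zero analyticAt_const I_ne_zero
  rcases lt_or_ge (meromorphicOrderAt f z) 0 with h | h
  · rw [sphereValue_of_order_neg h, sphereValue_of_order_neg (ho ▸ h), matT_smul_infty]
  · rw [sphereValue_of_order_nonneg h, sphereValue_of_order_nonneg (ho ▸ h), matT_smul_coe]
    congr 1
    exact apply_eq_of_eventuallyEq_nhdsNE (hg.analyticAt (ho ▸ h)).continuousAt
      (analyticAt_const.mul (hf.analyticAt h)).continuousAt he

end IsSpecialDevelopingMap

/-! ### The homomorphism `ψ` -/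

section Psi

variable {f : ℍ → ℂ → ℂ}

/-- The transformation law of a single element of `SL₂(ℤ)`. -/
def LawAt (f : ℍ → ℂ → ℂ) (γ : SL(2, ℤ)) (x : PSU2) : Prop :=
  ∀ (τ : ℍ) (z : ℂ), sphereValue (f (γ • τ)) ((cocycleJ γ τ)⁻¹ * z) = x • sphereValue (f τ) z

theorem LawAt.mul {γ δ : SL(2, ℤ)} {x y : PSU2} (h1 : LawAt f γ x) (h2 : LawAt f δ y) :
    LawAt f (γ * δ) (x * y) := by
  intro τ z
  rw [mul_smul γ δ τ, cocycleJ_mul, mul_inv, mul_assoc, h1, h2, mul_smul]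

theorem LawAt.inv {γ : SL(2, ℤ)} {x : PSU2} (h : LawAt f γ x) : LawAt f γ⁻¹ x⁻¹ := by
  intro τ z
  have hj : cocycleJ γ (γ⁻¹ • τ) * cocycleJ γ⁻¹ τ = 1 := by
    rw [← cocycleJ_mul, mul_inv_cancel]
    simp [cocycleJ]
  have := h (γ⁻¹ • τ) ((cocycleJ γ⁻¹ τ)⁻¹ * z)
  rw [smul_inv_smul, ← mul_assoc, ← mul_inv, hj, inv_one, one_mul] at this
  rw [this, inv_smul_smul]

theorem lawAt_one : LawAt f 1 1 := by
  intro τ z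
  simp [cocycleJ]

theorem LawAt.unique (hf : ∀ τ : ℍ, IsSpecialDevelopingMap τ (f τ)) {γ : SL(2, ℤ)} {x y : PSU2}
    (h1 : LawAt f γ x) (h2 : LawAt f γ y) : x = y :=
  (hf UpperHalfPlane.I).eq_of_smul_sphereValue fun z => by rw [← h1, ← h2]

theorem lawAt_T (hf : ∀ τ : ℍ, IsSpecialDevelopingMap τ (f τ)) :
    LawAt f ModularGroup.T (PSU2.mk matT) := by
  intro τ z
  have hj : cocycleJ ModularGroup.T τ = 1 := by simp [cocycleJ, ModularGroup.coe_T]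
  rw [hj, inv_one, one_mul]
  refine IsSpecialDevelopingMap.sphereValue_translation ?_ (hf τ) (hf _) z
  rw [coe_smul_eq, hj]
  simp [ModularGroup.coe_T]

/-- For `S⁻¹` the automorphy factor is `-τ`, whose inverse is `S⁻¹τ` itself, so the rescaled
variable is exactly the `τ'z` of the inversion law. -/
theorem lawAt_S_inv (hf : ∀ τ : ℍ, IsSpecialDevelopingMap τ (f τ)) :
    LawAt f ModularGroup.S⁻¹ (PSU2.mk matS) := by
  intro τ z
  have hS : (ModularGroup.S⁻¹ : SL(2, ℤ)).1 = !![0, 1; -1, 0] := by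
    simp [ModularGroup.coe_S, Matrix.adjugate_fin_two]
  have hj : cocycleJ ModularGroup.S⁻¹ τ = -τ := by rw [cocycleJ, hS]; simp
  have hc : ((ModularGroup.S⁻¹ • τ : ℍ) : ℂ) = (cocycleJ ModularGroup.S⁻¹ τ)⁻¹ := by
    rw [coe_smul_eq, hS]
    simp
  rw [← hc]
  refine IsSpecialDevelopingMap.sphereValue_inversion ?_ (hf τ) (hf _) z
  rw [hc, hj, inv_neg, neg_mul, inv_mul_cancel₀ τ.ne_zero]

theorem exists_lawAt (hf : ∀ τ : ℍ, IsSpecialDevelopingMap τ (f τ)) (γ : SL(2, ℤ)) :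
    ∃ x ∈ NK4, LawAt f γ x := by
  have hγ : γ ∈ Subgroup.closure {ModularGroup.S, ModularGroup.T} := by
    rw [SpecialLinearGroup.SL2Z_generators]
    exact Subgroup.mem_top γ
  induction hγ using Subgroup.closure_induction with
  | mem γ h =>
    rcases h with rfl | rfl
    · exact ⟨_, NK4.inv_mem matS_mem, by simpa using (lawAt_S_inv hf).inv⟩
    · exact ⟨_, matT_mem, lawAt_T hf⟩
  | one => exact ⟨1, NK4.one_mem, lawAt_one⟩
  | mul γ δ _ _ h1 h2 =>
    obtain ⟨x, hx, h1⟩ := h1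
    obtain ⟨y, hy, h2⟩ := h2
    exact ⟨_, NK4.mul_mem hx hy, h1.mul h2⟩
  | inv γ _ h =>
    obtain ⟨x, hx, h⟩ := h
    exact ⟨_, NK4.inv_mem hx, h.inv⟩

/-- The chosen values multiply correctly because the product of two of them satisfies the law of the
product matrix, and the law determines its group element. -/
theorem exists_psi (hf : ∀ τ : ℍ, IsSpecialDevelopingMap τ (f τ)) :
    ∃ ψ : SL(2, ℤ) →* NK4, TransformationLaw f ψ := by
  choose x hx hlaw using exists_lawAt hf
  exact ⟨MonoidHom.mk' (fun γ => ⟨x γ, hx γ⟩) fun γ δ =>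
    Subtype.ext ((hlaw (γ * δ)).unique hf ((hlaw γ).mul (hlaw δ))), hlaw⟩

/-- Moving `z` by `cτ + d` moves `j⁻¹z` by `1`, and moving it by `aτ + b` moves `j⁻¹z` by `γτ`.
Comparing the effects on both sides of the law shows how `x` conjugates `kA` and `kB`. -/
theorem lawAt_shift (hf : ∀ τ : ℍ, IsSpecialDevelopingMap τ (f τ)) {γ : SL(2, ℤ)} {x : PSU2}
    (h : LawAt f γ x) :
    kA * x = x * (kA ^ (γ 1 1) * kB ^ (γ 1 0)) ∧ kB * x = x * (kA ^ (γ 0 1) * kB ^ (γ 0 0)) := by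
  set τ : ℍ := UpperHalfPlane.I
  have hj := cocycleJ_ne_zero γ τ
  constructor
  · refine (hf τ).eq_of_smul_sphereValue fun z => ?_
    rw [mul_smul, mul_smul, ← (hf τ).sphereValue_add, ← h, ← h, ← (hf _).sphereValue_add_one]
    congr 1
    rw [add_assoc, mul_add, add_comm ((γ 1 1 : ℤ) : ℂ)]
    congr 1
    rw [eq_comm, inv_mul_eq_one₀ hj]
    rfl
  · refine (hf τ).eq_of_smul_sphereValue fun z => ?_
    rw [mul_smul, mul_smul, ← (hf τ).sphereValue_add, ← h, ← h, ← (hf _).sphereValue_add_tau]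
    congr 1
    rw [add_assoc, mul_add, add_comm ((γ 0 1 : ℤ) : ℂ), coe_smul_eq, div_eq_inv_mul]

theorem kA_zpow_smul_zero (n : ℤ) : kA ^ n • ((0 : ℂ) : OnePoint ℂ) = ((0 : ℂ) : OnePoint ℂ) := by
  rw [zpow_of_mul_self kA_mul_kA]
  split_ifs
  · rw [one_smul]
  · rw [kA_smul_coe, neg_zero]

theorem kB_zpow_smul_one (n : ℤ) : kB ^ n • ((1 : ℂ) : OnePoint ℂ) = ((1 : ℂ) : OnePoint ℂ) := by
  rw [zpow_of_mul_self kB_mul_kB]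
  split_ifs
  · rw [one_smul]
  · rw [kB_smul_coe one_ne_zero, inv_one]

theorem kA_zpow_smul_one (n : ℤ) :
    kA ^ n • ((1 : ℂ) : OnePoint ℂ) = ((1 : ℂ) : OnePoint ℂ) ↔ Even n := by
  rw [zpow_of_mul_self kA_mul_kA]
  split_ifs with h
  · simp [h]
  · rw [kA_smul_coe, OnePoint.coe_eq_coe]
    norm_num [h]

theorem kB_zpow_smul_zero (n : ℤ) :
    kB ^ n • ((0 : ℂ) : OnePoint ℂ) = ((0 : ℂ) : OnePoint ℂ) ↔ Even n := by
  rw [zpow_of_mul_self kB_mul_kB]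
  split_ifs with h
  · simp [h]
  · rw [kB_smul_zero]
    simp [h]

/-- For `γ ∈ Γ(2)` the scaled half-periods `j/2` and `jγτ/2` differ from `1/2` and `τ/2` by lattice
vectors, so the law at these points compares the values `0` and `1` with their images under `x` and
`K₄`. Half of each off-diagonal entry appears as an exponent, hence the condition modulo `4`. -/
theorem lawAt_eq_one_iff (hf : ∀ τ : ℍ, IsSpecialDevelopingMap τ (f τ)) {γ : SL(2, ℤ)} {x : PSU2}
    (h : LawAt f γ x) (hγ : γ ∈ CongruenceSubgroup.Gamma 2) :
    x = 1 ↔ (4 : ℤ) ∣ γ 0 1 ∧ (4 : ℤ) ∣ γ 1 0 := by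
  set τ : ℍ := UpperHalfPlane.I
  have hj := cocycleJ_ne_zero γ τ
  obtain ⟨hx1, hx2⟩ := lawAt_shift hf h
  obtain ⟨h1, h2⟩ := (mem_Gamma_two_iff γ).1 hγ
  rw [(klein_eq_kA_iff _ _).2 h1] at hx1
  rw [(klein_eq_kB_iff _ _).2 h2] at hx2
  obtain ⟨⟨d, hd⟩, ⟨c, hc⟩⟩ := h1
  obtain ⟨⟨b, hb⟩, ⟨a, ha⟩⟩ := h2
  have e0 : x • kB ^ c • ((0 : ℂ) : OnePoint ℂ) = ((0 : ℂ) : OnePoint ℂ) := by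
    have e : cocycleJ γ τ * (1 / 2) = 1 / 2 + d + c * (τ : ℂ) := by
      rw [cocycleJ, hd, hc]
      push_cast
      ring
    have := h τ (cocycleJ γ τ * (1 / 2))
    rw [inv_mul_cancel_left₀ hj, (hf _).sphereValue_half, e, (hf τ).sphereValue_add,
      (hf τ).sphereValue_half, K4_comm (K4.zpow_mem kA_mem d) (K4.zpow_mem kB_mem c), mul_smul,
      kA_zpow_smul_zero] at this
    exact this.symm
  have e1 : x • kA ^ b • ((1 : ℂ) : OnePoint ℂ) = ((1 : ℂ) : OnePoint ℂ) := by
    have e : cocycleJ γ τ * (((γ • τ : ℍ) : ℂ) / 2) = (τ : ℂ) / 2 + b + a * (τ : ℂ) := by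
      rw [coe_smul_eq, div_right_comm, mul_div_cancel₀ _ hj, hb, ha]
      push_cast
      ring
    have := h τ (cocycleJ γ τ * (((γ • τ : ℍ) : ℂ) / 2))
    rw [inv_mul_cancel_left₀ hj, (hf _).sphereValue_half_tau, e, (hf τ).sphereValue_add,
      (hf τ).sphereValue_half_tau, mul_smul, kB_zpow_smul_one] at this
    exact this.symm
  have h4b : (4 : ℤ) ∣ γ 0 1 ↔ Even b := by
    rw [hb, even_iff_two_dvd]
    omega
  have h4c : (4 : ℤ) ∣ γ 1 0 ↔ Even c := by
    rw [hc, even_iff_two_dvd]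
    omega
  rw [h4b, h4c]
  constructor
  · rintro rfl
    rw [one_smul] at e0 e1
    exact ⟨(kA_zpow_smul_one b).1 e1, (kB_zpow_smul_zero c).1 e0⟩
  · rintro ⟨hb', hc'⟩
    rw [(kB_zpow_smul_zero c).2 hc'] at e0
    rw [(kA_zpow_smul_one b).2 hb'] at e1
    -- Since `x` commutes with `kB` and fixes `0`, it fixes `∞ = kB • 0`.
    refine PSU2.eq_one_of_fixes x e0 e1 ?_
    rw [← kB_smul_zero, ← mul_smul, ← hx2, mul_smul, e0]

end Psi

/-! ### Taylor coefficients of families of analytic functions -/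

/-- A derivative in `z` is the Fréchet derivative in the direction `(0, 1)`, and that preserves
joint analyticity. -/
theorem analyticAt_iteratedDeriv_snd {H : ℂ × ℂ → ℂ} (hH : ∀ p, AnalyticAt ℂ H p) (k : ℕ)
    (p : ℂ × ℂ) : AnalyticAt ℂ (fun p => iteratedDeriv k (fun z => H (p.1, z)) p.2) p := by
  induction k generalizing p with
  | zero => simpa using hH p
  | succ k ih =>
    have e : (fun p : ℂ × ℂ => iteratedDeriv (k + 1) (fun z => H (p.1, z)) p.2) = fun p =>
        fderiv ℂ (fun p : ℂ × ℂ => iteratedDeriv k (fun z => H (p.1, z)) p.2) p (0, 1) := by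
      funext p
      rw [iteratedDeriv_succ]
      have h1 := (ih p).differentiableAt.hasFDerivAt
      have h2 : HasDerivAt (fun z : ℂ => (p.1, z)) (0, 1) p.2 :=
        (hasDerivAt_const _ _).prodMk (hasDerivAt_id _)
      exact (h1.comp_hasDerivAt (f := fun z : ℂ => (p.1, z)) p.2 h2).deriv
    rw [e]
    exact ((ContinuousLinearMap.apply ℂ ℂ ((0, 1) : ℂ × ℂ)).analyticAt _).comp (ih p).fderiv

/-- Taylor coefficients of a locally uniform limit depend holomorphically on the parameter. -/
theorem differentiableOn_iteratedDeriv_of_tendsto {G : ℕ → ℂ × ℂ → ℂ} {g : ℂ × ℂ → ℂ} {U : Set ℂ}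
    (hU : IsOpen U)
    (h : TendstoLocallyUniformlyOn G g Filter.atTop (U ×ˢ Metric.ball 0 2))
    (hG : ∀ N p, AnalyticAt ℂ (G N) p) (k : ℕ) :
    DifferentiableOn ℂ (fun q => iteratedDeriv k (fun z => g (q, z)) 0) U := by
  have hGz : ∀ N q z, AnalyticAt ℂ (fun z => G N (q, z)) z := fun N q z =>
    (hG N (q, z)).comp (analyticAt_const.prod analyticAt_id)
  have hgz : ∀ q ∈ U, DifferentiableOn ℂ (fun z => g (q, z)) (Metric.ball 0 2) := fun q hq =>
    (h.comp (fun z : ℂ => (q, z)) (t := Metric.ball 0 2) (fun z hz => ⟨hq, hz⟩)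
      (by fun_prop)).differentiableOn (Filter.Eventually.of_forall fun N z _ =>
        (hGz N q z).differentiableAt.differentiableWithinAt) Metric.isOpen_ball
  have hsub : Metric.closedBall (0 : ℂ) 1 ⊆ Metric.ball 0 2 :=
    Metric.closedBall_subset_ball (by norm_num)
  refine TendstoLocallyUniformlyOn.differentiableOn (φ := Filter.atTop)
    (F := fun (N : ℕ) q => iteratedDeriv k (fun z => G N (q, z)) 0) ?_
    (Filter.Eventually.of_forall fun N q _ => ?_) hU
  · rw [tendstoLocallyUniformlyOn_iff_forall_isCompact hU]
    intro K hKU hK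
    have hunif := (tendstoLocallyUniformlyOn_iff_forall_isCompact (hU.prod Metric.isOpen_ball)).1 h
      (K ×ˢ Metric.closedBall 0 1) (Set.prod_mono hKU hsub)
      (hK.prod (isCompact_closedBall _ _))
    rw [Metric.tendstoUniformlyOn_iff] at hunif ⊢
    intro ε hε
    have hkf : (0 : ℝ) < k.factorial := by exact_mod_cast k.factorial_pos
    -- Cauchy's estimate on the unit circle costs a factor `k!`, leaving `ε / 2 < ε`.
    filter_upwards [hunif (ε / (2 * k.factorial)) (by positivity)] with N hN q hq
    have han : AnalyticAt ℂ (fun z => g (q, z)) 0 :=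
      (hgz q (hKU hq)).analyticAt (Metric.ball_mem_nhds _ (by norm_num))
    rw [dist_eq_norm, ← iteratedDeriv_sub (f := fun z => g (q, z)) (g := fun z => G N (q, z))
      han.contDiffAt (hGz N q 0).contDiffAt]
    have hd : DiffContOnCl ℂ ((fun z => g (q, z)) - fun z => G N (q, z)) (Metric.ball 0 1) := by
      refine DifferentiableOn.diffContOnCl_ball (U := Metric.ball 0 2) ?_ hsub
      exact (hgz q (hKU hq)).sub fun z _ => (hGz N q z).differentiableAt.differentiableWithinAt
    have := Complex.norm_iteratedDeriv_le_of_forall_mem_sphere_norm_le k one_pos hd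
      (C := ε / (2 * k.factorial)) (fun z hz => by
        have := hN (q, z) ⟨hq, Metric.sphere_subset_closedBall hz⟩
        rw [dist_eq_norm] at this
        exact this.le)
    refine this.trans_lt ?_
    rw [one_pow, div_one, mul_div_assoc']
    rw [div_lt_iff₀ (by positivity)]
    nlinarith
  · exact ((analyticAt_iteratedDeriv_snd (hG N) k (q, 0)).comp (f := fun q : ℂ => (q, (0 : ℂ)))
      (by fun_prop)).differentiableAt.differentiableWithinAt

theorem differentiableOn_iteratedDeriv_qProd (s : ℕ) (a : ℂ) (k : ℕ) :
    DifferentiableOn ℂ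
      (fun q => iteratedDeriv k (fun z => qProd (q ^ s * exp (a * z)) (q ^ 8)) 0)
      (Metric.ball 0 1) := by
  intro q hq
  rw [mem_ball_zero_iff] at hq
  obtain ⟨r, hqr, hr⟩ := exists_between hq
  have hr0 : 0 ≤ r := (norm_nonneg q).trans hqr.le
  -- For `|q| < r < 1` and `|z| < 2` the first argument of `qProd` is at most `e^{2|a|}` in norm,
  -- and `|q⁸| < r`.
  have h := (tendstoLocallyUniformlyOn_qProd (R := Real.exp (‖a‖ * 2) + 1) (r := r) (by positivity)
    hr0 hr).comp (fun p : ℂ × ℂ => (p.1 ^ s * exp (a * p.2), p.1 ^ 8))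
    (t := Metric.ball 0 r ×ˢ Metric.ball 0 2) (fun p hp => by
      have h1 := mem_ball_zero_iff.1 hp.1
      have h2 := mem_ball_zero_iff.1 hp.2
      have h1' : ‖p.1‖ ≤ 1 := (h1.trans hr).le
      refine ⟨?_, ?_⟩
      · rw [mem_ball_zero_iff, norm_mul, norm_pow, Complex.norm_exp]
        have h3 : (a * p.2).re ≤ ‖a‖ * 2 := by
          refine (Complex.re_le_norm _).trans ?_
          rw [norm_mul]
          gcongr
        calc ‖p.1‖ ^ s * Real.exp (a * p.2).re ≤ 1 * Real.exp (‖a‖ * 2) := by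
              gcongr
              exact pow_le_one₀ (norm_nonneg _) h1'
          _ < Real.exp (‖a‖ * 2) + 1 := by linarith
      · rw [mem_ball_zero_iff, norm_pow]
        exact (pow_le_of_le_one (norm_nonneg _) h1' (by norm_num)).trans_lt h1) (by fun_prop)
  refine ((differentiableOn_iteratedDeriv_of_tendsto Metric.isOpen_ball h (fun N p => ?_)
    k).differentiableAt (Metric.isOpen_ball.mem_nhds
      (mem_ball_zero_iff.2 hqr))).differentiableWithinAt
  change AnalyticAt ℂ (fun p : ℂ × ℂ =>
    ∏ n ∈ Finset.range N, (1 + p.1 ^ s * exp (a * p.2) * (p.1 ^ 8) ^ n)) p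
  refine Finset.analyticAt_fun_prod _ fun n _ => ?_
  have h1 : AnalyticAt ℂ (fun p : ℂ × ℂ => p.1) p := analyticAt_fst
  have h2 : AnalyticAt ℂ (fun p : ℂ × ℂ => p.2) p := analyticAt_snd
  exact analyticAt_const.add
    (((h1.pow s).mul (analyticAt_const.mul h2).cexp).mul ((h1.pow 8).pow n))

/-! ### Functions of `q` and families with coefficients in them. -/

/-- The function `a` on the upper half plane is a function of `e^{2πiτ/4}` that is holomorphic in the
punctured unit disc and meromorphic at `0`. -/
def QMeromorphic (a : ℍ → ℂ) : Prop :=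
  ∃ Φ : ℂ → ℂ, DifferentiableOn ℂ Φ (Metric.ball 0 1 \ {0}) ∧ MeromorphicAt Φ 0 ∧
    ∀ τ, a τ = Φ (nome τ)

/-- Because `nome` covers the punctured disc, nonvanishing on `ℍ` gives nonvanishing of the function
of `q`; `QMeromorphic.inv` depends on this. -/
theorem exists_nome_eq {q : ℂ} (hq : q ∈ Metric.ball (0 : ℂ) 1 \ {0}) : ∃ τ : ℍ, nome τ = q := by
  have h0 : q ≠ 0 := hq.2
  have h1 : ‖q‖ < 1 := mem_ball_zero_iff.1 hq.1
  have him : 0 < (2 / (Real.pi * I) * Complex.log q).im := by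
    have e : 2 / (Real.pi * I) * Complex.log q = ((2 / Real.pi : ℝ) : ℂ) * (-I * Complex.log q) := by
      have := Real.pi_ne_zero
      push_cast
      field_simp
      rw [I_sq]
      ring
    rw [e, Complex.im_ofReal_mul]
    simp only [neg_mul, neg_im, mul_im, Complex.I_re, zero_mul, Complex.I_im, one_mul, zero_add, Complex.log_re]
    have := Real.log_neg (norm_pos_iff.2 h0) h1
    have := Real.pi_pos
    apply mul_pos (by positivity) (by linarith)
  refine ⟨⟨_, him⟩, ?_⟩
  rw [nome]
  have hπ : (Real.pi : ℂ) ≠ 0 := by exact_mod_cast Real.pi_ne_zero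
  have e : 2 * Real.pi * I * (2 / (Real.pi * I) * Complex.log q) / 4 = Complex.log q := by
    have := I_ne_zero
    field_simp
    ring
  change exp (2 * Real.pi * I * (2 / (Real.pi * I) * Complex.log q) / 4) = q
  rw [e, Complex.exp_log h0]

theorem nome_mem (τ : ℍ) : nome τ ∈ Metric.ball (0 : ℂ) 1 \ {0} :=
  ⟨mem_ball_zero_iff.2 (norm_nome_lt_one τ), nome_ne_zero τ⟩

namespace QMeromorphic

variable {a b : ℍ → ℂ}

theorem of_differentiableOn {Φ : ℂ → ℂ} (h : DifferentiableOn ℂ Φ (Metric.ball 0 1)) :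
    QMeromorphic fun τ => Φ (nome τ) :=
  ⟨Φ, h.mono Set.sdiff_subset,
    (h.analyticAt (Metric.ball_mem_nhds _ one_pos)).meromorphicAt, fun _ => rfl⟩

theorem const (c : ℂ) : QMeromorphic fun _ => c :=
  of_differentiableOn (Φ := fun _ => c) (differentiableOn_const c)

theorem add (ha : QMeromorphic a) (hb : QMeromorphic b) : QMeromorphic fun τ => a τ + b τ := by
  obtain ⟨Φ, h1, h2, h3⟩ := ha
  obtain ⟨Ψ, k1, k2, k3⟩ := hb
  exact ⟨_, h1.add k1, h2.add k2, fun τ => by simp [h3, k3]⟩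

theorem mul (ha : QMeromorphic a) (hb : QMeromorphic b) : QMeromorphic fun τ => a τ * b τ := by
  obtain ⟨Φ, h1, h2, h3⟩ := ha
  obtain ⟨Ψ, k1, k2, k3⟩ := hb
  exact ⟨_, h1.mul k1, h2.mul k2, fun τ => by simp [h3, k3]⟩

theorem inv (ha : QMeromorphic a) (h0 : ∀ τ, a τ ≠ 0) : QMeromorphic fun τ => (a τ)⁻¹ := by
  obtain ⟨Φ, h1, h2, h3⟩ := ha
  refine ⟨_, h1.inv fun q hq => ?_, h2.inv, fun τ => by simp [h3]⟩
  obtain ⟨τ, rfl⟩ := exists_nome_eq hq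
  rw [← h3]
  exact h0 τ

theorem sum {ι : Type*} (s : Finset ι) {a : ι → ℍ → ℂ} (h : ∀ i ∈ s, QMeromorphic (a i)) :
    QMeromorphic fun τ => ∑ i ∈ s, a i τ := by
  classical
  induction s using Finset.induction_on with
  | empty => simpa using const 0
  | insert i s hi ih =>
    simp only [Finset.sum_insert hi]
    exact (h i (Finset.mem_insert_self i s)).add
      (ih fun j hj => h j (Finset.mem_insert_of_mem hj))

theorem mdifferentiable (ha : QMeromorphic a) : MDifferentiable 𝓘(ℂ) 𝓘(ℂ) a := by
  obtain ⟨Φ, h1, -, h3⟩ := ha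
  rw [UpperHalfPlane.mdifferentiable_iff]
  have hmaps : ∀ z : ℂ, 0 < z.im →
      exp (2 * Real.pi * I * z / 4) ∈ Metric.ball (0 : ℂ) 1 \ {0} := fun z hz => nome_mem ⟨z, hz⟩
  have : DifferentiableOn ℂ (fun z => Φ (exp (2 * Real.pi * I * z / 4))) {z | 0 < z.im} :=
    h1.comp (f := fun z => exp (2 * Real.pi * I * z / 4)) (by fun_prop) hmaps
  refine this.congr fun z hz => ?_
  rw [Function.comp_apply, h3, nome, UpperHalfPlane.ofComplex_apply_of_im_pos hz]

end QMeromorphic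

/-- A family of functions analytic at `0` whose Taylor coefficients are meromorphic functions of
`e^{2πiτ/4}`. -/
structure QFamily (F : ℍ → ℂ → ℂ) : Prop where
  analyticAt : ∀ τ, AnalyticAt ℂ (F τ) 0
  coeff : ∀ k, QMeromorphic fun τ => iteratedDeriv k (F τ) 0

namespace QFamily

variable {F N D : ℍ → ℂ → ℂ}

theorem of_fixed {g : ℂ → ℂ} (hg : AnalyticAt ℂ g 0) : QFamily fun _ => g :=
  ⟨fun _ => hg, fun _ => QMeromorphic.const _⟩

theorem of_param {a : ℍ → ℂ} (ha : QMeromorphic a) : QFamily fun τ _ => a τ := by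
  refine ⟨fun _ => analyticAt_const, fun k => ?_⟩
  simp only [iteratedDeriv_const]
  split_ifs
  · exact ha
  · exact QMeromorphic.const 0

theorem add (hF : QFamily F) (hN : QFamily N) : QFamily fun τ z => F τ z + N τ z := by
  refine ⟨fun τ => (hF.analyticAt τ).add (hN.analyticAt τ), fun k => ?_⟩
  have e : (fun τ => iteratedDeriv k (fun z => F τ z + N τ z) 0) =
      fun τ => iteratedDeriv k (F τ) 0 + iteratedDeriv k (N τ) 0 := by
    funext τ
    exact iteratedDeriv_fun_add (hF.analyticAt τ).contDiffAt (hN.analyticAt τ).contDiffAt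
  rw [e]
  exact (hF.coeff k).add (hN.coeff k)

theorem mul (hF : QFamily F) (hN : QFamily N) : QFamily fun τ z => F τ z * N τ z := by
  refine ⟨fun τ => (hF.analyticAt τ).mul (hN.analyticAt τ), fun k => ?_⟩
  have e : (fun τ => iteratedDeriv k (fun z => F τ z * N τ z) 0) = fun τ =>
      ∑ i ∈ Finset.range (k + 1),
        k.choose i * iteratedDeriv i (F τ) 0 * iteratedDeriv (k - i) (N τ) 0 := by
    funext τ
    exact iteratedDeriv_fun_mul (hF.analyticAt τ).contDiffAt (hN.analyticAt τ).contDiffAt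
  rw [e]
  exact QMeromorphic.sum _ fun i _ =>
    ((QMeromorphic.const _).mul (hF.coeff i)).mul (hN.coeff (k - i))

/-- Leibniz's rule for `F D = N` expresses the `k`-th derivative of `F` at `0` through lower ones,
dividing only by `D(0)`. -/
theorem of_mul_eq (hF : ∀ τ, AnalyticAt ℂ (F τ) 0) (hD : QFamily D) (hN : QFamily N)
    (hD0 : ∀ τ, D τ 0 ≠ 0) (h : ∀ τ, ∀ᶠ z in 𝓝 0, F τ z * D τ z = N τ z) : QFamily F := by
  refine ⟨hF, fun k => ?_⟩
  induction k using Nat.strong_induction_on with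
  | _ k ih =>
    have hD0' : QMeromorphic fun τ => D τ 0 := by simpa using hD.coeff 0
    have e : (fun τ => iteratedDeriv k (F τ) 0) = fun τ => (iteratedDeriv k (N τ) 0 +
        (-1) * ∑ i ∈ Finset.range k,
          k.choose i * iteratedDeriv i (F τ) 0 * iteratedDeriv (k - i) (D τ) 0) * (D τ 0)⁻¹ := by
      funext τ
      have h1 : iteratedDeriv k (fun z => F τ z * D τ z) 0 = iteratedDeriv k (N τ) 0 :=
        Filter.EventuallyEq.iteratedDeriv_eq k (h τ)
      rw [iteratedDeriv_fun_mul (hF τ).contDiffAt (hD.analyticAt τ).contDiffAt,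
        Finset.sum_range_succ, Nat.choose_self, Nat.sub_self, iteratedDeriv_zero, Nat.cast_one,
        one_mul] at h1
      rw [eq_mul_inv_iff_mul_eq₀ (hD0 τ)]
      linear_combination h1
    rw [e]
    exact ((hN.coeff k).add ((QMeromorphic.const _).mul (QMeromorphic.sum _ fun i hi =>
      ((QMeromorphic.const _).mul (ih i (Finset.mem_range.1 hi))).mul (hD.coeff (k - i))))).mul
      (hD0'.inv hD0)

theorem qProd_exp (s : ℕ) (a : ℂ) :
    QFamily fun τ z => qProd (nome τ ^ s * exp (a * z)) (nome τ ^ 8) := by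
  refine ⟨fun τ => ?_, fun k =>
    QMeromorphic.of_differentiableOn (differentiableOn_iteratedDeriv_qProd s a k)⟩
  exact ((differentiable_qProd (norm_pow_lt_one (norm_nome_lt_one τ))).comp
    (f := fun z : ℂ => nome τ ^ s * exp (a * z)) (by fun_prop)).analyticAt 0

end QFamily

theorem qFamily_nome : QFamily fun τ _ => nome τ :=
  QFamily.of_param (QMeromorphic.of_differentiableOn (Φ := id) differentiableOn_id)

theorem qFamily_thetaDen : QFamily fun τ => thetaDen (nome τ) := by
  have h := (QFamily.qProd_exp 4 (2 * Real.pi * I)).mul (QFamily.qProd_exp 4 (-(2 * Real.pi * I)))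
  simp only [neg_mul] at h
  exact h

theorem qFamily_thetaNum : QFamily fun τ => thetaNum (nome τ) := by
  have h := (QFamily.qProd_exp 8 (2 * Real.pi * I)).mul (QFamily.qProd_exp 8 (-(2 * Real.pi * I)))
  simp only [neg_mul] at h
  exact (QFamily.of_fixed (g := fun z => 2 * Complex.cos (Real.pi * z)) (by fun_prop)).mul h

theorem thetaDen_zero_ne_zero (τ : ℍ) : thetaDen (nome τ) 0 ≠ 0 := by
  have hq := norm_nome_lt_one τ
  have h : qProd (nome τ ^ 4) (nome τ ^ 8) ≠ 0 := by
    refine qProd_ne_zero (norm_pow_lt_one hq) fun n hn => ?_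
    have h1 : nome τ ^ (4 + 8 * n) = -1 := by
      rw [pow_add, pow_mul]
      linear_combination hn
    have h2 : ‖nome τ ^ (4 + 8 * n)‖ < 1 := by
      rw [norm_pow]
      exact pow_lt_one₀ (norm_nonneg _) hq (by omega)
    rw [h1, norm_neg, norm_one] at h2
    exact lt_irrefl _ h2
  simpa [thetaDen] using h

/-! ### Taylor coefficients of `f`: modularity and behaviour at the cusps. -/

section Taylor

variable {f : ℍ → ℂ → ℂ}

theorem qFamily_developing (hf : ∀ τ : ℍ, IsSpecialDevelopingMap τ (f τ)) : QFamily f := by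
  refine QFamily.of_mul_eq (fun τ => (hf τ).analyticAt_zero) qFamily_thetaDen
    (qFamily_nome.mul qFamily_thetaNum) thetaDen_zero_ne_zero fun τ => ?_
  have h1 := (hf τ).analyticAt_zero.mul (qFamily_thetaDen.analyticAt τ)
  have h2 : AnalyticAt ℂ (fun z => nome τ * thetaNum (nome τ) z) 0 :=
    (qFamily_nome.mul qFamily_thetaNum).analyticAt τ
  exact (h1.continuousAt.eventuallyEq_nhds_iff_eventuallyEq_nhdsNE h2.continuousAt).1
    ((hf τ).mul_thetaDen 0)

/-- Both functions are finite near `z = 0`, so the law on the sphere becomes an identity of complex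
numbers, and the Möbius denominator cannot vanish. -/
theorem eventually_moebius (hf : ∀ τ : ℍ, IsSpecialDevelopingMap τ (f τ)) {γ : SL(2, ℤ)} {A : SU2}
    (h : LawAt f γ (PSU2.mk A)) (τ : ℍ) :
    ∀ᶠ z in 𝓝 (0 : ℂ), A.1 1 0 * f τ z + A.1 1 1 ≠ 0 ∧
      f (γ • τ) ((cocycleJ γ τ)⁻¹ * z) * (A.1 1 0 * f τ z + A.1 1 1) =
        A.1 0 0 * f τ z + A.1 0 1 := by
  have h1 := (hf τ).analyticAt_zero.eventually_analyticAt
  have h2 : ∀ᶠ z in 𝓝 (0 : ℂ), AnalyticAt ℂ (f (γ • τ)) ((cocycleJ γ τ)⁻¹ * z) := by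
    have hc : Filter.Tendsto (fun z => (cocycleJ γ τ)⁻¹ * z) (𝓝 0) (𝓝 0) := by
      have : ContinuousAt (fun z => (cocycleJ γ τ)⁻¹ * z) 0 := by fun_prop
      simpa [ContinuousAt] using this
    exact hc.eventually (hf (γ • τ)).analyticAt_zero.eventually_analyticAt
  filter_upwards [h1, h2] with z hz1 hz2
  have := h τ z
  rw [IsSpecialDevelopingMap.sphereValue_of_order_nonneg hz1.meromorphicOrderAt_nonneg,
    IsSpecialDevelopingMap.sphereValue_of_order_nonneg hz2.meromorphicOrderAt_nonneg, PSU2.mk_smul_coe] at this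
  split_ifs at this with h0
  · exact absurd this (OnePoint.coe_ne_infty _)
  · rw [OnePoint.coe_eq_coe, eq_div_iff h0] at this
    exact ⟨h0, this⟩

theorem analyticAt_rescaled (hf : ∀ τ : ℍ, IsSpecialDevelopingMap τ (f τ)) (γ : SL(2, ℤ)) (τ : ℍ) :
    AnalyticAt ℂ (fun z => f (γ • τ) ((cocycleJ γ τ)⁻¹ * z)) 0 := by
  have h := (hf (γ • τ)).analyticAt_zero
  rw [← mul_zero (cocycleJ γ τ)⁻¹] at h
  exact h.comp (f := fun z => (cocycleJ γ τ)⁻¹ * z) (by fun_prop)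

/-- The Möbius relation exhibits the rescaled function as a quotient of affine functions of `f`, so
expansions at all cusps follow from the one at `i∞`. -/
theorem qFamily_rescaled (hf : ∀ τ : ℍ, IsSpecialDevelopingMap τ (f τ)) {γ : SL(2, ℤ)} {x : PSU2}
    (h : LawAt f γ x) : QFamily fun τ z => f (γ • τ) ((cocycleJ γ τ)⁻¹ * z) := by
  obtain ⟨A, rfl⟩ := QuotientGroup.mk_surjective x
  have hlin : ∀ c d : ℂ, QFamily fun τ z => c * f τ z + d := fun c d =>
    ((QFamily.of_fixed analyticAt_const).mul (qFamily_developing hf)).add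
      (QFamily.of_fixed analyticAt_const)
  exact QFamily.of_mul_eq (analyticAt_rescaled hf γ) (hlin _ _) (hlin _ _)
    (fun τ => (eventually_moebius hf h τ).self_of_nhds.1)
    fun τ => (eventually_moebius hf h τ).mono fun z hz => hz.2

theorem iteratedDeriv_comp_const_mul_apply (g : ℂ → ℂ) (c : ℂ) (k : ℕ) (z : ℂ) :
    iteratedDeriv k (fun z => g (c * z)) z = c ^ k * iteratedDeriv k g (c * z) := by
  induction k generalizing z with
  | zero => simp
  | succ k ih =>
    rw [iteratedDeriv_succ, funext ih, deriv_const_mul_field,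
      deriv_comp_mul_left c (iteratedDeriv k g), iteratedDeriv_succ, smul_eq_mul, pow_succ, mul_assoc]

theorem iteratedDeriv_rescaled (γ : SL(2, ℤ)) (k : ℕ) (τ : ℍ) :
    iteratedDeriv k (fun z => f (γ • τ) ((cocycleJ γ τ)⁻¹ * z)) 0 =
      (cocycleJ γ τ)⁻¹ ^ k * (k.factorial * taylorCoeff f k (γ • τ)) := by
  rw [iteratedDeriv_comp_const_mul_apply, mul_zero, taylorCoeff,
    mul_div_cancel₀ _ (Nat.cast_ne_zero.2 k.factorial_ne_zero)]

theorem qMeromorphic_taylorCoeff (hf : ∀ τ : ℍ, IsSpecialDevelopingMap τ (f τ)) (k : ℕ) :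
    QMeromorphic (taylorCoeff f k) :=
  ((qFamily_developing hf).coeff k).mul (QMeromorphic.const _)

theorem qMeromorphic_slash (hf : ∀ τ : ℍ, IsSpecialDevelopingMap τ (f τ)) {γ : SL(2, ℤ)} {x : PSU2}
    (h : LawAt f γ x) (k : ℕ) : QMeromorphic (taylorCoeff f k ∣[(k : ℤ)] γ) := by
  have hk : (k.factorial : ℂ) ≠ 0 := Nat.cast_ne_zero.2 k.factorial_ne_zero
  have e : (taylorCoeff f k ∣[(k : ℤ)] γ) = fun τ =>
      iteratedDeriv k (fun z => f (γ • τ) ((cocycleJ γ τ)⁻¹ * z)) 0 * (k.factorial : ℂ)⁻¹ := by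
    funext τ
    have hd : UpperHalfPlane.denom γ τ = cocycleJ γ τ := by
      simp [UpperHalfPlane.denom, cocycleJ]
    rw [iteratedDeriv_rescaled, ModularForm.SL_slash_apply, hd, zpow_neg, zpow_natCast, inv_pow]
    field_simp
  rw [e]
  exact ((qFamily_rescaled hf h).coeff k).mul (QMeromorphic.const _)

theorem taylorCoeff_smul (hf : ∀ τ : ℍ, IsSpecialDevelopingMap τ (f τ)) {γ : SL(2, ℤ)}
    (h : LawAt f γ 1) (k : ℕ) (τ : ℍ) :
    taylorCoeff f k (γ • τ) = cocycleJ γ τ ^ k * taylorCoeff f k τ := by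
  have hk : (k.factorial : ℂ) ≠ 0 := Nat.cast_ne_zero.2 k.factorial_ne_zero
  have he : (fun z => f (γ • τ) ((cocycleJ γ τ)⁻¹ * z)) =ᶠ[𝓝 0] f τ := by
    filter_upwards [eventually_moebius (A := 1) hf h τ] with z hz
    simpa using hz.2
  have h1 := he.iteratedDeriv_eq k
  rw [iteratedDeriv_rescaled] at h1
  rw [taylorCoeff, taylorCoeff, ← h1, taylorCoeff]
  have := cocycleJ_ne_zero γ τ
  rw [inv_pow]
  field_simp

end Taylor

/-! ### Assembly of the theorem. -/

theorem mainTheorem10 (f : ℍ → ℂ → ℂ) (hf : ∀ τ : ℍ, IsSpecialDevelopingMap τ (f τ)) :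
    (∃ ψ : SL(2, ℤ) →* NK4,
      TransformationLaw f ψ ∧
      (∀ ψ' : SL(2, ℤ) →* NK4, TransformationLaw f ψ' → ψ' = ψ) ∧
      Function.Surjective ψ ∧
      ψ.ker = Subgroup.closure {-1} ⊔ CongruenceSubgroup.Gamma 4 ∧
      (K4.subgroupOf NK4).comap ψ = CongruenceSubgroup.Gamma 2 ∧
      (∃ e : SL(2, ZMod 4) ⧸ Subgroup.zpowers (-1 : SL(2, ZMod 4)) ≃* NK4, ∀ γ : SL(2, ℤ),
        e (QuotientGroup.mk (Matrix.SpecialLinearGroup.map (Int.castRingHom (ZMod 4)) γ)) = ψ γ) ∧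
      (∃ e : SL(2, ZMod 2) ≃* NK4 ⧸ K4.subgroupOf NK4, ∀ γ : SL(2, ℤ),
        e (Matrix.SpecialLinearGroup.map (Int.castRingHom (ZMod 2)) γ) =
          QuotientGroup.mk (ψ γ)) ∧
      (ψ ⟨!![1, 1; 0, 1], by simp⟩ : PSU2) = PSU2.mk matT ∧
      (ψ ⟨!![0, 1; -1, 0], by simp⟩ : PSU2) = PSU2.mk matS) ∧
    Nonempty (NK4 ≃* Equiv.Perm (Fin 4)) ∧
    Nonempty (NK4 ⧸ K4.subgroupOf NK4 ≃* Equiv.Perm (Fin 3)) ∧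
    (∀ τ : ℍ, HasFPowerSeriesAt (f τ)
      (FormalMultilinearSeries.ofScalars ℂ (fun k => taylorCoeff f k τ)) 0) ∧
    ∀ k : ℕ,
      MDifferentiable 𝓘(ℂ) 𝓘(ℂ) (taylorCoeff f k) ∧
      (∀ γ ∈ CongruenceSubgroup.Gamma 4, ∀ τ : ℍ,
        taylorCoeff f k (γ • τ) = cocycleJ γ τ ^ k * taylorCoeff f k τ) ∧
      MeromorphicAtCusps k (taylorCoeff f k) := by
  obtain ⟨ψ, hψ⟩ := exists_psi hf
  have hlaw : ∀ γ, LawAt f γ (ψ γ : PSU2) := hψ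
  have eS : (⟨!![0, 1; -1, 0], by simp⟩ : SL(2, ℤ)) = ModularGroup.S⁻¹ :=
    Subtype.ext (by simp [ModularGroup.coe_S, Matrix.adjugate_fin_two])
  have hT : (ψ ⟨!![1, 1; 0, 1], by simp⟩ : PSU2) = PSU2.mk matT :=
    LawAt.unique hf (hlaw _) (lawAt_T hf)
  have hS : (ψ ⟨!![0, 1; -1, 0], by simp⟩ : PSU2) = PSU2.mk matS := by
    rw [eS]
    exact LawAt.unique hf (hlaw _) (lawAt_S_inv hf)
  have hsurj : Function.Surjective ψ := psi_surjective ψ hT hS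
  have hK : (K4.subgroupOf NK4).comap ψ = CongruenceSubgroup.Gamma 2 :=
    psi_comap_K4 ψ (fun γ => (lawAt_shift hf (hlaw γ)).1) fun γ => (lawAt_shift hf (hlaw γ)).2
  have hker := psi_ker_eq hK fun γ hγ =>
    (show ψ γ = 1 ↔ (ψ γ : PSU2) = 1 by simp).trans (lawAt_eq_one_iff hf (hlaw γ) hγ)
  have hker' := hker.trans comap_zpowers_neg_one
  obtain ⟨e, he⟩ := exists_equiv_mod_four hsurj hker
  obtain ⟨e', he'⟩ := exists_equiv_mod_two hsurj hK
  refine ⟨⟨ψ, hψ, fun ψ' hψ' => MonoidHom.ext fun γ => Subtype.ext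
    (LawAt.unique hf (hψ' γ) (hlaw γ)), hsurj, hker', hK, ⟨e, he⟩, ⟨e', he'⟩, hT, hS⟩,
    NK4_equiv_perm e e', NK4_quotient_equiv_perm e', fun τ =>
    (hf τ).analyticAt_zero.hasFPowerSeriesAt, fun k =>
    ⟨(qMeromorphic_taylorCoeff hf k).mdifferentiable, fun γ hγ τ => ?_, fun γ => ?_⟩⟩
  · have h1 : ψ γ = 1 := MonoidHom.mem_ker.1 (hker' ▸ Subgroup.mem_sup_right hγ)
    have h := hlaw γ
    rw [h1] at h
    exact taylorCoeff_smul hf h k τ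
  -- The expression in `q` is valid on all of `ℍ`, not only near `i∞`.
  · obtain ⟨Φ, _, hΦ, h⟩ := qMeromorphic_slash hf (hlaw γ) k
    exact ⟨Φ, hΦ, Filter.Eventually.of_forall h⟩
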